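/- Let $\mathbb T^2=\mathbb R^2/\mathbb Z^2$, $\frac12<\alpha<1$, $s+\alpha>2$ and $T>0$. Let $K:\mathbb T^2\to\mathbb R$ satisfy $K\in L^1(\mathbb T^2)\cap C^\infty(\mathbb T^2\setminus\{0\})$ and, for some constants $c,C>0$, $c|k|^{-1}\le \hat K(k)\le C|k|^{-1}$ for all $k\in\mathbb Z^2\setminus\{0\}$ (in particular $\hat K(k)$ is real). Put $\mathcal K\theta=K*\theta$ and $\mathcal R\theta=(-\partial_2\mathcal K\theta,\ \partial_1\mathcal K\theta)$, and suppose that $\mathcal R$ is bounded on $L^p(\mathbb T^2)$ for every $p\in(1,\infty)$. Let $H^r(\mathbb T^2)$ carry the norm $\|u\|_{H^r}^2=\sum_{k\in\mathbb Z^2}(1+|k|^2)^r|\hat u(k)|^2$, and let $(-\Delta)^\alpha$ be the Fourier multiplier with symbol $|2\pi k|^{2\alpha}$. For a real-valued source $f\in C_c^\infty(\mathbb T^2\times(0,T))$ let $\theta_f\in L^\infty(0,T;H^s(\mathbb T^2))\cap L^2(0,T;H^{s+\alpha}(\mathbb T^2))$ denote a real-valued weak solution of $$\partial_t\theta+\mathcal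 R\theta\cdot\nabla\theta+(-\Delta)^\alpha\theta=f\ \text{ in }\mathbb T^2\times(0,T),\qquad \theta(0)=0 .$$ Let $f_1,f_2\in C_c^\infty(\mathbb T^2\times(0,T))$ be real-valued and, for $j=1,2$, let $w_j\in L^2(0,T;H^\alpha(\mathbb T^2))\cap C([0,T];L^2(\mathbb T^2))$ denote the weak solution of the linear problem $$\partial_t w+(-\Delta)^\alpha w=f_j\ \text{ in }\mathbb T^2\times(0,T),\qquad w(0)=0 .$$ (Weak solutions are understood by testing against $\varphi\in C_c^\infty(\mathbb T^2\times(-\infty,T))$, restricted to times in $(0,T)$, with zero initial data.) Suppose that solutions $\theta_{\epsilon f_1}$, $\theta_{\epsilon f_2}$, $\theta_{\epsilon(f_1+f_2)}$ in this class are given for all sufficiently small real $\epsilon\ne0$. Then, for $j=1,2$, $$\frac{\theta_{\epsilon f_j}}{\epsilon}\to w_j,\qquad \frac{\theta_{\epsilon(f_1+f_2)}-\theta_{\epsilon f_j}}{\epsilon}\to w_{3-j}$$ in $L^2(0,T;H^{2\alpha}(\mathbb T^2))\cap L^\infty(0,T;H^{\alpha}(\mathbb T^2))$ as $\epsilon\to0$,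 $\epsilon\neq0$. -/

import Mathlib

open MeasureTheory Set Filter
open scoped Topology ENNReal NNReal ContDiff

noncomputable section

namespace ActiveScalar

/-- The two-dimensional torus `ℝ² / ℤ²`. -/
abbrev Torus : Type := UnitAddTorus (Fin 2)

/-- Lebesgue measure on the torus, of total mass one. -/
abbrev torusMeasure : Measure Torus := Measure.pi fun _ => AddCircle.haarAddCircle

/-- Real square integrable functions on the torus, modulo null sets. -/
abbrev L2Torus : Type := Lp ℝ 2 torusMeasure

/-- The quotient map `ℝ² → 𝕋²`. -/
def toTorus (x : Fin 2 → ℝ) : Torus := fun i => (x i : UnitAddCircle)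

/-- The Euclidean length `|k|` of a frequency. -/
def freqNorm (k : Fin 2 → ℤ) : ℝ := Real.sqrt (∑ i, (k i : ℝ) ^ 2)

/-- The Fourier coefficient `∫ g(x) e^{-2πi k·x} dx` of a real function. -/
def torusCoeff (g : Torus → ℝ) (k : Fin 2 → ℤ) : ℂ :=
  UnitAddTorus.mFourierCoeff (fun x => (g x : ℂ)) k

/-! Sobolev spaces and time-dependent functions -/

/-- The norm of `H^r(𝕋²)`, equal to `∞` off `H^r(𝕋²)`. -/
def sobolevNorm (r : ℝ) (g : L2Torus) : ℝ≥0∞ :=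
  (∑' k : Fin 2 → ℤ,
    ENNReal.ofReal ((1 + freqNorm k ^ 2) ^ r * ‖torusCoeff g k‖ ^ 2)) ^ (1 / 2 : ℝ)

/-- The norm of `L^p(0, T; H^r(𝕋²))`, possibly `∞`. -/
def bochnerNorm (p : ℝ≥0∞) (r T : ℝ) (v : ℝ → L2Torus) : ℝ≥0∞ :=
  eLpNorm (fun t => sobolevNorm r (v t)) p (volume.restrict (Ioo 0 T))

/-- Membership in `L^p(0, T; H^r(𝕋²))`, for `r ≥ 0`. -/
def MemBochner (p : ℝ≥0∞) (r T : ℝ) (v : ℝ → L2Torus) : Prop :=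
  AEStronglyMeasurable v (volume.restrict (Ioo 0 T)) ∧ bochnerNorm p r T v < ⊤

/-! Test functions and derivatives -/

/-- Smooth real functions on the torus. -/
def SmoothOnTorus (g : Torus → ℝ) : Prop :=
  ContDiff ℝ ∞ fun x : Fin 2 → ℝ => g (toTorus x)

/-- `φ ∈ C_c^∞(I × 𝕋²)` for an open set `I` of times, extended by zero to all times. -/
def IsTestFunction (I : Set ℝ) (φ : ℝ → Torus → ℝ) : Prop :=
  ContDiff ℝ ∞ (fun p : ℝ × (Fin 2 → ℝ) => φ p.1 (toTorus p.2)) ∧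
    HasCompactSupport (Function.uncurry φ) ∧
    tsupport (Function.uncurry φ) ⊆ I ×ˢ univ

/-- The classical partial derivative `∂_j g` on the torus. -/
def partialDeriv (j : Fin 2) (g : Torus → ℝ) (x : Torus) : ℝ :=
  deriv (fun h : ℝ => g (x + Pi.single j (h : UnitAddCircle))) 0

/-- `v` is the weak partial derivative `∂_j g` on the torus. -/
def IsWeakPartial (j : Fin 2) (g v : Torus → ℝ) : Prop :=
  Integrable g torusMeasure ∧ Integrable v torusMeasure ∧
    ∀ ψ : Torus → ℝ, SmoothOnTorus ψ →
      ∫ x, g x * partialDeriv j ψ x ∂torusMeasure = -∫ x, v x * ψ x ∂torusMeasure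

/-- The fractional Laplacian `(-Δ)^r g = ∑_k |2πk|^{2r} ĝ(k) e^{2πi k·x}` of a smooth real
function `g`. The series converges absolutely and its sum is real. -/
def fracLaplacian (r : ℝ) (g : Torus → ℝ) (x : Torus) : ℝ :=
  (∑' k : Fin 2 → ℤ, (((2 * Real.pi * freqNorm k) ^ (2 * r) : ℝ) : ℂ) *
    torusCoeff g k * UnitAddTorus.mFourier k x).re

/-! The drift velocity -/

/-- The operator `𝒦g = K * g`. -/
def kernelConv (K g : Torus → ℝ) (x : Torus) : ℝ :=
  ∫ y, K (x - y) * g y ∂torusMeasure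

/-- `u = ℛg`, that is, `u = (-∂₂(𝒦g), ∂₁(𝒦g))` with weak derivatives. The coordinates, numbered
1 and 2 in this formula, are numbered 0 and 1 in `Fin 2`. -/
def IsVelocity (K g : Torus → ℝ) (u : Fin 2 → Torus → ℝ) : Prop :=
  IsWeakPartial 1 (kernelConv K g) (fun x => -u 0 x) ∧
    IsWeakPartial 0 (kernelConv K g) (u 1)

/-- The standing assumptions on the kernel `K` and on the operator `ℛ` that it generates. -/
structure IsAdmissibleKernel (K : Torus → ℝ) : Prop where
  integrable : Integrable K torusMeasure
  smooth : ContDiffOn ℝ ∞ (fun x : Fin 2 → ℝ => K (toTorus x)) {x | toTorus x ≠ 0}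
  coeff_bounds : ∃ c C : ℝ, 0 < c ∧ 0 < C ∧ ∀ k : Fin 2 → ℤ, k ≠ 0 →
    (torusCoeff K k).im = 0 ∧
      c * (freqNorm k)⁻¹ ≤ (torusCoeff K k).re ∧
      (torusCoeff K k).re ≤ C * (freqNorm k)⁻¹
  bounded_Lp : ∀ p : ℝ≥0∞, 1 < p → p < ⊤ → ∃ C : ℝ≥0, ∀ g : Torus → ℝ,
    MemLp g p torusMeasure → ∃ u : Fin 2 → Torus → ℝ, IsVelocity K g u ∧
      ∀ j, MemLp (u j) p torusMeasure ∧
        eLpNorm (u j) p torusMeasure ≤ C * eLpNorm g p torusMeasure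

/-! The equations -/

/-- `v` is a weak solution of `∂_t v + (-Δ)^α v = F` on `𝕋² × (0, T)` with `v(0) = 0`. The test
functions need not vanish at time `0`, which is how the initial condition enters. -/
def SolvesWeakly (α T : ℝ) (F : ℝ → Torus → ℝ) (v : ℝ → L2Torus) : Prop :=
  ∀ φ : ℝ → Torus → ℝ, IsTestFunction (Iio T) φ →
    ∫ t in Ioo 0 T, ∫ x, (-(v t x * deriv (fun τ => φ τ x) t) +
        v t x * fracLaplacian α (φ t) x) ∂torusMeasure =
      ∫ t in Ioo 0 T, ∫ x, F t x * φ t x ∂torusMeasure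

/-- `w` is the solution of the linear problem `∂_t w + (-Δ)^α w = f`, `w(0) = 0`, in
`L²(0, T; H^α) ∩ C([0, T]; L²)`. -/
structure IsLinearSolution (α T : ℝ) (f : ℝ → Torus → ℝ) (w : ℝ → L2Torus) : Prop where
  memL2 : MemBochner 2 α T w
  continuousOn : ContinuousOn w (Icc 0 T)
  initial : w 0 = 0
  solves : SolvesWeakly α T f w

/-- `θ` is the solution of the active scalar equation `∂_t θ + ℛθ·∇θ + (-Δ)^α θ = f`,
`θ(0) = 0`, in `L^∞(0, T; H^s) ∩ L²(0, T; H^{s+α})`. Here `u` is the velocity `ℛθ` and `G` is the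
weak gradient `∇θ`. -/
structure IsActiveScalarSolution (α s T : ℝ) (K : Torus → ℝ) (f : ℝ → Torus → ℝ)
    (θ : ℝ → L2Torus) : Prop where
  memLinfty : MemBochner ⊤ s T θ
  memL2 : MemBochner 2 (s + α) T θ
  solves : ∃ u G : ℝ → Fin 2 → Torus → ℝ,
    (∀ᵐ t ∂volume.restrict (Ioo 0 T),
      IsVelocity K (θ t) (u t) ∧ ∀ j, IsWeakPartial j (θ t) (G t j)) ∧
    SolvesWeakly α T (fun t x => f t x - ∑ j, u t j x * G t j x) θ

/-- `v_ε → v` in `L²(0, T; H^{2α}) ∩ L^∞(0, T; H^α)` as `ε → 0`, `ε ≠ 0`. -/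
def ConvergesTo (α T : ℝ) (v : ℝ → ℝ → L2Torus) (v₀ : ℝ → L2Torus) : Prop :=
  Tendsto (fun ε => bochnerNorm 2 (2 * α) T fun t => v ε t - v₀ t) (𝓝[≠] 0) (𝓝 0) ∧
    Tendsto (fun ε => bochnerNorm ⊤ α T fun t => v ε t - v₀ t) (𝓝[≠] 0) (𝓝 0)

end ActiveScalar

end

open ActiveScalar

/-!
In Fourier coefficients, `∂_t v + (-Δ)^α v = F` with `v(0) = 0` is solved mode by mode by Duhamel's
formula, and this gains `2α` derivatives: `F ∈ L²(0, T; H^{s-α})` controls `v` in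
`L²(0, T; H^{s+α}) ∩ L^∞(0, T; H^s)`. Since `𝒦` gains the derivative that `ℛ` loses, the transport
term obeys `‖ℛθ·∇θ‖_{H^{s-α}} ≲ ‖θ‖_{H^s} ‖θ‖_{H^{s+α}}` as soon as `s + α > 2`, which closes the
estimate for small data: by continuity in time, the total forcing `εf - ℛθ·∇θ` stays of size `O(ε)`
in `L²(0, t; H^{s-α})` up to `t = T`. Hence `ℛθ·∇θ` is `O(ε²)` there, and `ε⁻¹θ - w`, which solves
the linear problem with source `-ε⁻¹ ℛθ·∇θ`, is `O(ε)`.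
-/

noncomputable section

namespace ActiveScalar

/-! ### Young's inequality -/

lemma ennreal_add_sq_le (x y : ℝ≥0∞) : (x + y) ^ 2 ≤ 2 * x ^ 2 + 2 * y ^ 2 := by
  have := ENNReal.rpow_add_le_mul_rpow_add_rpow x y (p := 2) one_le_two
  norm_num only [ENNReal.rpow_two, ENNReal.rpow_one] at this
  rwa [mul_add] at this

lemma lintegral_mul_sq_le {X : Type*} [MeasurableSpace X] {μ : Measure X} {g h : X → ℝ≥0∞}
    (hg : AEMeasurable g μ) (hh : AEMeasurable h μ) :
    (∫⁻ x, g x * h x ∂μ) ^ 2 ≤ (∫⁻ x, g x ∂μ) * ∫⁻ x, g x * h x ^ 2 ∂μ := by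
  -- the Cauchy-Schwarz inequality for `√g` and `√g h`
  have cauchy_schwarz := ENNReal.lintegral_mul_le_Lp_mul_Lq μ .two_two
    (f := fun x => g x ^ (1 / 2 : ℝ)) (g := fun x => g x ^ (1 / 2 : ℝ) * h x)
    (hg.pow_const _) ((hg.pow_const _).mul hh)
  have sqrt_mul_sqrt (x : ℝ≥0∞) : x ^ (1 / 2 : ℝ) * x ^ (1 / 2 : ℝ) = x := by
    rw [← ENNReal.rpow_add_of_nonneg _ _ (by norm_num) (by norm_num)]
    norm_num
  have sq_sqrt (x : ℝ≥0∞) : (x ^ (1 / 2 : ℝ)) ^ 2 = x := by rw [sq, sqrt_mul_sqrt]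
  simp only [Pi.mul_apply, ← mul_assoc, sqrt_mul_sqrt, ENNReal.rpow_two, mul_pow, sq_sqrt]
    at cauchy_schwarz
  calc _ ≤ _ := pow_le_pow_left' cauchy_schwarz 2
    _ = _ := by rw [mul_pow, sq_sqrt, sq_sqrt]

section Young

variable {G : Type*} [AddCommGroup G] [MeasurableSpace G] [MeasurableAdd₂ G] [MeasurableNeg G]
  {μ : Measure G} [SFinite μ] [μ.IsAddLeftInvariant] {f g : G → ℝ≥0∞}

lemma lintegral_lconvolution (hf : AEMeasurable f μ) (hg : AEMeasurable g μ) :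
    ∫⁻ x, (f ⋆ₗ[μ] g) x ∂μ = (∫⁻ x, f x ∂μ) * ∫⁻ x, g x ∂μ := by
  have hfg : AEMeasurable (Function.uncurry fun x y => f y * g (-y + x)) (μ.prod μ) := by fun_prop
  calc ∫⁻ x, (f ⋆ₗ[μ] g) x ∂μ = ∫⁻ y, ∫⁻ x, f y * g (-y + x) ∂μ ∂μ :=
        lintegral_lintegral_swap hfg
    _ = ∫⁻ y, f y * ∫⁻ x, g x ∂μ ∂μ := by
        refine lintegral_congr fun y => ?_
        rw [← lintegral_add_left_eq_self g (-y)]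
        exact lintegral_const_mul'' _
          (hg.comp_quasiMeasurePreserving (quasiMeasurePreserving_add_left μ (-y)))
    _ = _ := lintegral_mul_const'' _ hf

lemma lconvolution_sq_le (hf : AEMeasurable f μ) (hg : AEMeasurable g μ) (x : G) :
    (f ⋆ₗ[μ] g) x ^ 2 ≤ (∫⁻ y, f y ∂μ) * (f ⋆ₗ[μ] fun y => g y ^ 2) x := by
  have hgx : AEMeasurable (fun y => g (-y + x)) μ := by
    simp only [neg_add_eq_sub]
    exact hg.comp_quasiMeasurePreserving (quasiMeasurePreserving_sub_left μ x)
  exact lintegral_mul_sq_le hf hgx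

lemma lintegral_lconvolution_sq_le (hf : AEMeasurable f μ) (hg : AEMeasurable g μ) :
    ∫⁻ x, (f ⋆ₗ[μ] g) x ^ 2 ∂μ ≤ (∫⁻ x, f x ∂μ) ^ 2 * ∫⁻ x, g x ^ 2 ∂μ := by
  have hg2 : AEMeasurable (fun x => g x ^ 2) μ := hg.pow_const 2
  calc ∫⁻ x, (f ⋆ₗ[μ] g) x ^ 2 ∂μ
      ≤ ∫⁻ x, (∫⁻ y, f y ∂μ) * (f ⋆ₗ[μ] fun y => g y ^ 2) x ∂μ :=
        lintegral_mono fun x => lconvolution_sq_le hf hg x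
    _ = _ := by
        rw [lintegral_const_mul'' _ (aemeasurable_lconvolution hf hg2),
          lintegral_lconvolution hf hg2, sq, mul_assoc]

end Young

/-! ### Weighted sequence spaces -/

/-- Frequencies, the dual group of the torus. -/
abbrev Freq : Type := Fin 2 → ℤ

/-- The Sobolev weight `(1 + |k|²)^r`. -/
def sobolevWeight (r : ℝ) (k : Freq) : ℝ≥0∞ := ENNReal.ofReal ((1 + freqNorm k ^ 2) ^ r)

/-- The squared `H^r` norm of a family of Fourier coefficients. The values may be extended
nonnegative numbers, so that it applies to the majorants of Fourier coefficients as well. -/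
def sobolevSq {E : Type*} [ENorm E] (r : ℝ) (a : Freq → E) : ℝ≥0∞ :=
  ∑' k, sobolevWeight r k * ‖a k‖ₑ ^ 2

lemma freqNorm_nonneg (k : Freq) : 0 ≤ freqNorm k := Real.sqrt_nonneg _

lemma freqNorm_sq (k : Freq) : freqNorm k ^ 2 = (k 0 : ℝ) ^ 2 + (k 1 : ℝ) ^ 2 := by
  rw [freqNorm, Real.sq_sqrt (Finset.sum_nonneg fun i _ => sq_nonneg _), Fin.sum_univ_two]

lemma abs_coord_le_freqNorm (k : Freq) (j : Fin 2) : |(k j : ℝ)| ≤ freqNorm k :=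
  Real.abs_le_sqrt <| Finset.single_le_sum (f := fun i => (k i : ℝ) ^ 2)
    (fun _ _ => sq_nonneg _) (Finset.mem_univ j)

lemma norm_le_freqNorm (k : Freq) : ‖k‖ ≤ freqNorm k :=
  (pi_norm_le_iff_of_nonneg (freqNorm_nonneg k)).mpr fun j => by
    simpa only [Int.norm_eq_abs] using abs_coord_le_freqNorm k j

lemma one_add_freqNorm_sq_pos (k : Freq) : 0 < 1 + freqNorm k ^ 2 := by positivity

lemma one_add_freqNorm_sq_le (k l : Freq) :
    1 + freqNorm k ^ 2 ≤ 4 * max (1 + freqNorm l ^ 2) (1 + freqNorm (k - l) ^ 2) := by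
  have parallelogram : freqNorm k ^ 2 ≤ 2 * freqNorm l ^ 2 + 2 * freqNorm (k - l) ^ 2 := by
    simp only [freqNorm_sq, Pi.sub_apply, Int.cast_sub]
    nlinarith [sq_nonneg ((k 0 : ℝ) - 2 * l 0), sq_nonneg ((k 1 : ℝ) - 2 * l 1)]
  linarith [le_max_left (1 + freqNorm l ^ 2) (1 + freqNorm (k - l) ^ 2),
    le_max_right (1 + freqNorm l ^ 2) (1 + freqNorm (k - l) ^ 2)]

lemma sobolevWeight_ne_top (r : ℝ) (k : Freq) : sobolevWeight r k ≠ ⊤ := ENNReal.ofReal_ne_top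

lemma sobolevWeight_ne_zero (r : ℝ) (k : Freq) : sobolevWeight r k ≠ 0 := by
  rw [sobolevWeight, Ne, ENNReal.ofReal_eq_zero, not_le]
  exact Real.rpow_pos_of_pos (one_add_freqNorm_sq_pos k) r

lemma sobolevWeight_zero (k : Freq) : sobolevWeight 0 k = 1 := by
  simp only [sobolevWeight, Real.rpow_zero, ENNReal.ofReal_one]

lemma sobolevWeight_add (r q : ℝ) (k : Freq) :
    sobolevWeight (r + q) k = sobolevWeight r k * sobolevWeight q k := by
  have hk := one_add_freqNorm_sq_pos k
  rw [sobolevWeight, sobolevWeight, sobolevWeight, ← ENNReal.ofReal_mul (by positivity),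
    Real.rpow_add hk]

lemma sobolevWeight_neg_mul_self (r : ℝ) (k : Freq) :
    sobolevWeight (-r) k * sobolevWeight r k = 1 := by
  rw [← sobolevWeight_add, neg_add_cancel, sobolevWeight_zero]

lemma sobolevWeight_half_sq (r : ℝ) (k : Freq) :
    sobolevWeight (r / 2) k ^ 2 = sobolevWeight r k := by
  rw [sq, ← sobolevWeight_add, add_halves]

lemma sobolevWeight_mono {r q : ℝ} (h : r ≤ q) (k : Freq) :
    sobolevWeight r k ≤ sobolevWeight q k :=
  ENNReal.ofReal_le_ofReal <|
    Real.rpow_le_rpow_of_exponent_le (le_add_of_nonneg_right (sq_nonneg _)) h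

lemma sobolevWeight_le_mul_add {r : ℝ} (hr : 0 ≤ r) (k l : Freq) :
    sobolevWeight r k ≤
      ENNReal.ofReal (4 ^ r) * (sobolevWeight r l + sobolevWeight r (k - l)) := by
  simp only [sobolevWeight]
  set x := 1 + freqNorm l ^ 2
  set y := 1 + freqNorm (k - l) ^ 2
  have hx : 0 < x := one_add_freqNorm_sq_pos l
  have hy : 0 < y := one_add_freqNorm_sq_pos (k - l)
  rw [← ENNReal.ofReal_add (by positivity) (by positivity), ← ENNReal.ofReal_mul (by positivity)]
  refine ENNReal.ofReal_le_ofReal ?_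
  calc (1 + freqNorm k ^ 2) ^ r ≤ (4 * max x y) ^ r :=
        Real.rpow_le_rpow (one_add_freqNorm_sq_pos k).le (one_add_freqNorm_sq_le k l) hr
    _ = 4 ^ r * max (x ^ r) (y ^ r) := by
        rw [Real.mul_rpow (by norm_num) (hx.le.trans (le_max_left _ _)),
          (Real.monotoneOn_rpow_Ici_of_exponent_nonneg hr).map_max hx.le hy.le]
    _ ≤ 4 ^ r * (x ^ r + y ^ r) := by
        gcongr
        exact max_le_add_of_nonneg (by positivity) (by positivity)

lemma tsum_sobolevWeight_neg_lt_top {r : ℝ} (hr : 1 < r) : ∑' k, sobolevWeight (-r) k < ⊤ := by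
  refine Summable.tsum_ofReal_lt_top <| Summable.of_norm_bounded_eventually
    (EisensteinSeries.summable_one_div_norm_rpow (k := 2 * r) (by linarith)) ?_
  filter_upwards [(finite_singleton (0 : Freq)).compl_mem_cofinite] with k hk
  have hk₀ : 0 < ‖k‖ := norm_pos_iff.mpr hk
  have hle : ‖k‖ ^ 2 ≤ freqNorm k ^ 2 := by gcongr; exact norm_le_freqNorm k
  rw [Real.norm_of_nonneg (Real.rpow_nonneg (one_add_freqNorm_sq_pos k).le _),
    show -(2 * r) = 2 * (-r) by ring, Real.rpow_mul hk₀.le, Real.rpow_two]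
  exact Real.rpow_le_rpow_of_nonpos (by positivity) (by linarith) (by linarith)

lemma sobolevSq_mono {E : Type*} [ENorm E] {r q : ℝ} (h : r ≤ q) (a : Freq → E) :
    sobolevSq r a ≤ sobolevSq q a :=
  ENNReal.tsum_le_tsum fun k => by gcongr; exact sobolevWeight_mono h k

lemma sobolevSq_weight_mul (r q : ℝ) (a : Freq → ℝ≥0∞) :
    sobolevSq r (fun k => sobolevWeight (q / 2) k * a k) = sobolevSq (r + q) a := by
  simp only [sobolevSq, enorm_eq_self, mul_pow, sobolevWeight_half_sq, sobolevWeight_add r q,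
    mul_assoc]

lemma tsum_weight_mul_sq {E : Type*} [ENorm E] (r : ℝ) (a : Freq → E) :
    ∑' k, (sobolevWeight (r / 2) k * ‖a k‖ₑ) ^ 2 = sobolevSq r a := by
  simp only [mul_pow, sobolevWeight_half_sq, sobolevSq]

lemma sobolevSq_add_le {E : Type*} [TopologicalSpace E] [ESeminormedAddMonoid E] (r : ℝ)
    (a b : Freq → E) :
    sobolevSq r (fun k => a k + b k) ≤ 2 * sobolevSq r a + 2 * sobolevSq r b := by
  simp only [sobolevSq]
  rw [← ENNReal.tsum_mul_left, ← ENNReal.tsum_mul_left, ← ENNReal.tsum_add]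
  refine ENNReal.tsum_le_tsum fun k => ?_
  calc sobolevWeight r k * ‖a k + b k‖ₑ ^ 2
      ≤ sobolevWeight r k * (2 * ‖a k‖ₑ ^ 2 + 2 * ‖b k‖ₑ ^ 2) := by
        gcongr
        exact (pow_le_pow_left' (enorm_add_le _ _) 2).trans (ennreal_add_sq_le _ _)
    _ = _ := by ring

lemma sobolevSq_neg {E : Type*} [SeminormedAddCommGroup E] (r : ℝ) (a : Freq → E) :
    sobolevSq r (fun k => -a k) = sobolevSq r a := by
  simp only [sobolevSq, enorm_neg]

lemma sobolevSq_const_mul (r : ℝ) (c : ℂ) (a : Freq → ℂ) :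
    sobolevSq r (fun k => c * a k) = ‖c‖ₑ ^ 2 * sobolevSq r a := by
  simp only [sobolevSq, ← ENNReal.tsum_mul_left, enorm_mul, mul_pow]
  exact tsum_congr fun k => mul_left_comm _ _ _

lemma sobolevNorm_eq (r : ℝ) (g : L2Torus) :
    sobolevNorm r g = sobolevSq r (torusCoeff g) ^ (1 / 2 : ℝ) := by
  rw [sobolevNorm, sobolevSq]
  congr 1
  refine tsum_congr fun k => ?_
  rw [ENNReal.ofReal_mul (Real.rpow_nonneg (one_add_freqNorm_sq_pos k).le r),
    ENNReal.ofReal_pow (norm_nonneg _), ofReal_norm, sobolevWeight]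

lemma sobolevNorm_sq (r : ℝ) (g : L2Torus) :
    sobolevNorm r g ^ 2 = sobolevSq r (torusCoeff g) := by
  rw [sobolevNorm_eq, ← ENNReal.rpow_natCast, ← ENNReal.rpow_mul]
  norm_num

lemma sq_tsum_enorm_le_sobolevSq {E : Type*} [ENorm E] (r : ℝ) (a : Freq → E) :
    (∑' k, ‖a k‖ₑ) ^ 2 ≤ (∑' k, sobolevWeight (-r) k) * sobolevSq r a := by
  have := lintegral_mul_sq_le (μ := Measure.count) (g := sobolevWeight (-r))
    (h := fun k => sobolevWeight r k * ‖a k‖ₑ) .of_discrete .of_discrete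
  simpa only [lintegral_count, sobolevSq, mul_pow, sq (sobolevWeight r _), ← mul_assoc,
    sobolevWeight_neg_mul_self, one_mul] using this

/-! ### The bilinear estimate -/

lemma tsum_lconvolution_sq_le (a b : Freq → ℝ≥0∞) :
    ∑' k, (a ⋆ₗ[Measure.count] b) k ^ 2 ≤ (∑' k, a k) ^ 2 * ∑' k, b k ^ 2 := by
  simpa only [lintegral_count] using
    lintegral_lconvolution_sq_le (μ := Measure.count) (f := a) (g := b) .of_discrete .of_discrete

lemma sobolevWeight_mul_lconvolution_le {r : ℝ} (hr : 0 ≤ r) (a b : Freq → ℝ≥0∞) (k : Freq) :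
    sobolevWeight r k * (a ⋆ₗ[Measure.count] b) k ≤ ENNReal.ofReal (4 ^ r) *
      (((fun l => sobolevWeight r l * a l) ⋆ₗ[Measure.count] b) k +
        (a ⋆ₗ[Measure.count] fun l => sobolevWeight r l * b l) k) := by
  simp only [lconvolution_def, lintegral_count, neg_add_eq_sub]
  rw [← ENNReal.tsum_add, ← ENNReal.tsum_mul_left, ← ENNReal.tsum_mul_left]
  refine ENNReal.tsum_le_tsum fun l => ?_
  calc sobolevWeight r k * (a l * b (k - l))
      ≤ ENNReal.ofReal (4 ^ r) * (sobolevWeight r l + sobolevWeight r (k - l)) *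
        (a l * b (k - l)) := by
        gcongr
        exact sobolevWeight_le_mul_add hr k l
    _ = _ := by ring

-- The weight of the output frequency is moved to the factor that carries the larger frequency,
-- and the other factor is placed in `ℓ¹`.
lemma sobolevSq_lconvolution_le {r : ℝ} (hr : 0 ≤ r) (p q : ℝ) (a b : Freq → ℝ≥0∞) :
    sobolevSq r (a ⋆ₗ[Measure.count] b) ≤ 2 * ENNReal.ofReal (4 ^ (r / 2)) ^ 2 *
      ((∑' k, sobolevWeight (-q) k) * (sobolevSq r a * sobolevSq q b) +
        (∑' k, sobolevWeight (-p) k) * (sobolevSq p a * sobolevSq r b)) := by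
  set D := ENNReal.ofReal (4 ^ (r / 2))
  set W := sobolevWeight (r / 2)
  have pointwise (k : Freq) : (W k * (a ⋆ₗ[Measure.count] b) k) ^ 2 ≤
      2 * D ^ 2 * ((b ⋆ₗ[Measure.count] fun l => W l * a l) k ^ 2 +
        (a ⋆ₗ[Measure.count] fun l => W l * b l) k ^ 2) := by
    rw [lconvolution_comm (f := b)]
    set X := ((fun l => W l * a l) ⋆ₗ[Measure.count] b) k
    set Y := (a ⋆ₗ[Measure.count] fun l => W l * b l) k
    calc (W k * (a ⋆ₗ[Measure.count] b) k) ^ 2 ≤ (D * (X + Y)) ^ 2 :=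
          pow_le_pow_left' (sobolevWeight_mul_lconvolution_le (by linarith) a b k) 2
      _ = D ^ 2 * (X + Y) ^ 2 := mul_pow _ _ _
      _ ≤ D ^ 2 * (2 * X ^ 2 + 2 * Y ^ 2) := by gcongr; exact ennreal_add_sq_le X Y
      _ = _ := by ring
  rw [← tsum_weight_mul_sq]
  refine (ENNReal.tsum_le_tsum pointwise).trans ?_
  rw [ENNReal.tsum_mul_left, ENNReal.tsum_add]
  gcongr 2 * D ^ 2 * (?_ + ?_)
  · calc _ ≤ (∑' k, b k) ^ 2 * ∑' k, (W k * a k) ^ 2 := tsum_lconvolution_sq_le _ _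
      _ ≤ ((∑' k, sobolevWeight (-q) k) * sobolevSq q b) * sobolevSq r a :=
          mul_le_mul' (sq_tsum_enorm_le_sobolevSq q b) (tsum_weight_mul_sq r a).le
      _ = _ := by ring
  · calc _ ≤ (∑' k, a k) ^ 2 * ∑' k, (W k * b k) ^ 2 := tsum_lconvolution_sq_le _ _
      _ ≤ ((∑' k, sobolevWeight (-p) k) * sobolevSq p a) * sobolevSq r b :=
          mul_le_mul' (sq_tsum_enorm_le_sobolevSq p a) (tsum_weight_mul_sq r b).le
      _ = _ := by ring

lemma exists_sobolevSq_mul_deriv_le {α s : ℝ} (hα : 1 / 2 ≤ α) (hαs : α ≤ s) (hs : 2 < s + α) :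
    ∃ C : ℝ≥0∞, C ≠ ⊤ ∧ ∀ a : Freq → ℝ≥0∞,
      sobolevSq (s - α) (a ⋆ₗ[Measure.count] fun l => sobolevWeight (1 / 2) l * a l) ≤
        C * (sobolevSq s a * sobolevSq (s + α) a) := by
  set D := ENNReal.ofReal (4 ^ ((s - α) / 2))
  set S₁ := ∑' k, sobolevWeight (-(s + α - 1)) k
  set S₂ := ∑' k, sobolevWeight (-s) k
  have hS₁ : S₁ ≠ ⊤ := (tsum_sobolevWeight_neg_lt_top (by linarith)).ne
  have hS₂ : S₂ ≠ ⊤ := (tsum_sobolevWeight_neg_lt_top (by linarith)).ne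
  refine ⟨2 * D ^ 2 * (S₁ + S₂), by finiteness, fun a => ?_⟩
  calc _ ≤ 2 * D ^ 2 * (S₁ * (sobolevSq (s - α) a * sobolevSq (s + α - 1 + 1) a) +
          S₂ * (sobolevSq s a * sobolevSq (s - α + 1) a)) := by
        rw [← sobolevSq_weight_mul, ← sobolevSq_weight_mul]
        exact sobolevSq_lconvolution_le (by linarith) s (s + α - 1) a _
    _ ≤ 2 * D ^ 2 * (S₁ * (sobolevSq s a * sobolevSq (s + α) a) +
          S₂ * (sobolevSq s a * sobolevSq (s + α) a)) := by
        gcongr <;> exact sobolevSq_mono (by linarith) a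
    _ = _ := by ring

/-! ### The parabolic estimate -/

/-- The solution of `a' + lam a = F`, `a(0) = 0`. -/
def duhamel (lam : ℝ) (F : ℝ → ℂ) (t : ℝ) : ℂ :=
  ∫ τ in Ioo 0 t, (Real.exp (-(lam * (t - τ))) : ℂ) * F τ

/-- The symbol of `(-Δ)^α`. -/
def heatRate (α : ℝ) (k : Freq) : ℝ := (2 * Real.pi * freqNorm k) ^ (2 * α)

/-- The squared norm of `L²(0, T; H^r)` of a time-dependent family of Fourier coefficients. -/
def energy (r T : ℝ) (F : ℝ → Freq → ℂ) : ℝ≥0∞ := ∫⁻ t in Ioo 0 T, sobolevSq r (F t)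

/-- The heat kernel of a single mode, cut off to the times `(0, T)`. -/
def modeKernel (lam T : ℝ) : ℝ → ℝ≥0∞ :=
  (Ioo 0 T).indicator fun σ => ENNReal.ofReal (Real.exp (-(lam * σ)))

/-- `L²(0, T; H^r)`, described by the Fourier coefficients of its elements. -/
structure MemEnergySpace (r T : ℝ) (F : ℝ → Freq → ℂ) : Prop where
  aemeasurable (k : Freq) : AEMeasurable (fun t => F t k) (volume.restrict (Ioo 0 T))
  energy_lt_top : energy r T F < ⊤

/-- At almost every time, the coefficients `a` solve `a' + |2πk|^{2α} a = F`, `a(0) = 0`, on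
`(0, T)`, the solution being the one given by Duhamel's formula. -/
def SolvesModes (α T : ℝ) (F a : ℝ → Freq → ℂ) : Prop :=
  ∀ᵐ t ∂volume.restrict (Ioo 0 T), ∀ k, a t k = duhamel (heatRate α k) (fun τ => F τ k) t

/-- The coefficients `a` have squared norm at most `M` both in `L²(0, T; H^{s+α})` and in
`L^∞(0, T; H^s)`, the spaces in which the parabolic estimate controls solutions. -/
structure HasParabolicBound (α s T : ℝ) (M : ℝ≥0∞) (a : ℝ → Freq → ℂ) : Prop where
  aemeasurable (k : Freq) : AEMeasurable (fun t => a t k) (volume.restrict (Ioo 0 T))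
  energy_le : energy (s + α) T a ≤ M
  ae_sobolevSq_le : ∀ᵐ t ∂volume.restrict (Ioo 0 T), sobolevSq s (a t) ≤ M

lemma heatRate_nonneg (α : ℝ) (k : Freq) : 0 ≤ heatRate α k :=
  Real.rpow_nonneg (mul_nonneg Real.two_pi_pos.le (freqNorm_nonneg k)) _

lemma measurable_modeKernel (lam T : ℝ) : Measurable (modeKernel lam T) :=
  Measurable.indicator (by fun_prop) measurableSet_Ioo

section ModeKernel

variable {lam T : ℝ}

lemma modeKernel_le_indicator_one (hlam : 0 ≤ lam) :
    modeKernel lam T ≤ (Ioo 0 T).indicator 1 :=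
  fun _ => indicator_le_indicator' fun hσ =>
    ENNReal.ofReal_le_one.mpr <| Real.exp_le_one_iff.mpr <|
      neg_nonpos.mpr <| mul_nonneg hlam hσ.1.le

lemma modeKernel_le_one (hlam : 0 ≤ lam) (σ : ℝ) : modeKernel lam T σ ≤ 1 :=
  (modeKernel_le_indicator_one hlam σ).trans (indicator_le_self' (fun _ _ => zero_le) σ)

lemma lintegral_modeKernel_le (hlam : 0 ≤ lam) :
    ∫⁻ σ, modeKernel lam T σ ≤ ENNReal.ofReal T := by
  calc ∫⁻ σ, modeKernel lam T σ ≤ ∫⁻ σ, (Ioo 0 T).indicator 1 σ :=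
        lintegral_mono (modeKernel_le_indicator_one hlam)
    _ = ENNReal.ofReal T := by
        rw [lintegral_indicator_one measurableSet_Ioo, Real.volume_Ioo, sub_zero]

lemma lintegral_modeKernel_le_inv (hlam : 0 < lam) :
    ∫⁻ σ, modeKernel lam T σ ≤ ENNReal.ofReal lam⁻¹ := by
  have integrable := integrableOn_exp_mul_Ioi (neg_lt_zero.mpr hlam) 0
  have integral := integral_exp_mul_Ioi (neg_lt_zero.mpr hlam) 0
  simp only [neg_mul, mul_zero, Real.exp_zero, neg_div_neg_eq, one_div]
    at integrable integral
  rw [modeKernel, lintegral_indicator measurableSet_Ioo, ← integral,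
    ofReal_integral_eq_lintegral_ofReal integrable (ae_of_all _ fun x => (Real.exp_pos _).le)]
  exact lintegral_mono_set Ioo_subset_Ioi_self

end ModeKernel

lemma one_le_freqNorm {k : Freq} (hk : k ≠ 0) : 1 ≤ freqNorm k := by
  obtain ⟨j, hj⟩ := Function.ne_iff.mp hk
  calc (1 : ℝ) ≤ |(k j : ℝ)| := by exact_mod_cast Int.one_le_abs hj
    _ ≤ freqNorm k := abs_coord_le_freqNorm k j

lemma freqNorm_zero : freqNorm 0 = 0 := by
  simp only [freqNorm, Pi.zero_apply, Int.cast_zero, zero_pow two_ne_zero, Finset.sum_const_zero,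
    Real.sqrt_zero]

lemma one_add_freqNorm_sq_rpow_le_heatRate {α : ℝ} (hα : 0 ≤ α) {k : Freq} (hk : k ≠ 0) :
    (1 + freqNorm k ^ 2) ^ α ≤ heatRate α k := by
  have hk₁ := one_le_freqNorm hk
  rw [heatRate, Real.rpow_mul (by positivity), Real.rpow_two]
  refine Real.rpow_le_rpow (one_add_freqNorm_sq_pos k).le ?_ hα
  calc 1 + freqNorm k ^ 2 ≤ (2 * freqNorm k) ^ 2 := by nlinarith
    _ ≤ (2 * Real.pi * freqNorm k) ^ 2 := by
        gcongr
        linarith [Real.pi_gt_three]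

-- The gain of `2α` derivatives in the parabolic estimate, one frequency at a time.
lemma sobolevWeight_mul_lintegral_modeKernel_le {α T : ℝ} (hα : 0 ≤ α) (hT : 0 ≤ T) (k : Freq) :
    sobolevWeight α k * ∫⁻ σ, modeKernel (heatRate α k) T σ ≤ ENNReal.ofReal (1 + T) := by
  rcases eq_or_ne k 0 with rfl | hk
  · rw [sobolevWeight, freqNorm_zero, zero_pow two_ne_zero, add_zero, Real.one_rpow,
      ENNReal.ofReal_one, one_mul]
    exact (lintegral_modeKernel_le (heatRate_nonneg α 0)).trans
      (ENNReal.ofReal_le_ofReal (by linarith))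
  · have weight_le := one_add_freqNorm_sq_rpow_le_heatRate hα hk
    have weight_pos : 0 < (1 + freqNorm k ^ 2) ^ α :=
      Real.rpow_pos_of_pos (one_add_freqNorm_sq_pos k) α
    calc _ ≤ sobolevWeight α k * ENNReal.ofReal (heatRate α k)⁻¹ := by
          gcongr
          exact lintegral_modeKernel_le_inv (weight_pos.trans_le weight_le)
      _ = ENNReal.ofReal ((1 + freqNorm k ^ 2) ^ α / heatRate α k) := by
          rw [sobolevWeight, ← ENNReal.ofReal_mul weight_pos.le, div_eq_mul_inv]
      _ ≤ ENNReal.ofReal (1 + T) :=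
          ENNReal.ofReal_le_ofReal <|
            (div_le_one_of_le₀ weight_le (heatRate_nonneg α k)).trans (by linarith)

section Duhamel

variable {lam T : ℝ} {F : ℝ → ℂ}

lemma enorm_duhamel_le_lconvolution {t : ℝ} (ht : t ≤ T) :
    ‖duhamel lam F t‖ₑ ≤ (modeKernel lam T ⋆ₗ (Ioo 0 T).indicator fun τ => ‖F τ‖ₑ) t := by
  rw [lconvolution_comm]
  refine (enorm_integral_le_lintegral_enorm _).trans ?_
  rw [← lintegral_indicator measurableSet_Ioo]
  refine lintegral_mono (indicator_le fun τ hτ => ?_)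
  have hτT : τ ∈ Ioo 0 T := ⟨hτ.1, hτ.2.trans_le ht⟩
  have htτ : -τ + t ∈ Ioo 0 T := ⟨by linarith [hτ.2], by linarith [hτ.1]⟩
  rw [enorm_mul, modeKernel, indicator_of_mem htτ, indicator_of_mem hτT, mul_comm,
    ← ofReal_norm (Complex.ofReal _), Complex.norm_real, Real.norm_of_nonneg (Real.exp_pos _).le,
    neg_add_eq_sub]

lemma lintegral_indicator_enorm_sq :
    ∫⁻ τ, (Ioo 0 T).indicator (fun τ => ‖F τ‖ₑ) τ ^ 2 = ∫⁻ τ in Ioo 0 T, ‖F τ‖ₑ ^ 2 := by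
  rw [← lintegral_indicator measurableSet_Ioo]
  exact lintegral_congr fun τ => by
    by_cases hτ : τ ∈ Ioo 0 T <;> simp [hτ]

lemma enorm_duhamel_sq_le (hlam : 0 ≤ lam) (hF : AEMeasurable F (volume.restrict (Ioo 0 T)))
    {t : ℝ} (ht : t ≤ T) :
    ‖duhamel lam F t‖ₑ ^ 2 ≤
      (∫⁻ σ, modeKernel lam T σ) * ∫⁻ τ in Ioo 0 T, ‖F τ‖ₑ ^ 2 := by
  set h := (Ioo 0 T).indicator fun τ => ‖F τ‖ₑ
  have hh : AEMeasurable h := (aemeasurable_indicator_iff measurableSet_Ioo).mpr hF.enorm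
  calc ‖duhamel lam F t‖ₑ ^ 2 ≤ (modeKernel lam T ⋆ₗ h) t ^ 2 := by
        gcongr
        exact enorm_duhamel_le_lconvolution ht
    _ ≤ (∫⁻ σ, modeKernel lam T σ) * ∫⁻ σ, modeKernel lam T σ * h (-σ + t) ^ 2 :=
        lconvolution_sq_le (measurable_modeKernel lam T).aemeasurable hh t
    _ ≤ (∫⁻ σ, modeKernel lam T σ) * ∫⁻ σ, h (-σ + t) ^ 2 := by
        gcongr with σ
        exact mul_le_of_le_one_left zero_le (modeKernel_le_one hlam σ)
    _ = _ := by
        simp only [neg_add_eq_sub]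
        rw [lintegral_sub_left_eq_self (fun τ => h τ ^ 2) t, lintegral_indicator_enorm_sq]

lemma lintegral_enorm_duhamel_sq_le (hF : AEMeasurable F (volume.restrict (Ioo 0 T))) :
    ∫⁻ t in Ioo 0 T, ‖duhamel lam F t‖ₑ ^ 2 ≤
      (∫⁻ σ, modeKernel lam T σ) ^ 2 * ∫⁻ τ in Ioo 0 T, ‖F τ‖ₑ ^ 2 := by
  set h := (Ioo 0 T).indicator fun τ => ‖F τ‖ₑ
  have hh : AEMeasurable h := (aemeasurable_indicator_iff measurableSet_Ioo).mpr hF.enorm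
  calc _ ≤ ∫⁻ t in Ioo 0 T, (modeKernel lam T ⋆ₗ h) t ^ 2 :=
        setLIntegral_mono' measurableSet_Ioo fun t ht =>
          pow_le_pow_left' (enorm_duhamel_le_lconvolution ht.2.le) 2
    _ ≤ ∫⁻ t, (modeKernel lam T ⋆ₗ h) t ^ 2 := setLIntegral_le_lintegral _ _
    _ ≤ (∫⁻ σ, modeKernel lam T σ) ^ 2 * ∫⁻ τ, h τ ^ 2 :=
        lintegral_lconvolution_sq_le (measurable_modeKernel lam T).aemeasurable hh
    _ = _ := by rw [lintegral_indicator_enorm_sq]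

end Duhamel

lemma energy_eq_tsum (r : ℝ) {T : ℝ} {F : ℝ → Freq → ℂ}
    (hF : ∀ k, AEMeasurable (fun t => F t k) (volume.restrict (Ioo 0 T))) :
    energy r T F = ∑' k, sobolevWeight r k * ∫⁻ t in Ioo 0 T, ‖F t k‖ₑ ^ 2 := by
  unfold energy sobolevSq
  rw [lintegral_tsum fun k => ((hF k).enorm.pow_const 2).const_mul _]
  exact tsum_congr fun k => lintegral_const_mul' _ _ (sobolevWeight_ne_top r k)

lemma sobolevSq_duhamel_le {α T : ℝ} (hα : 0 ≤ α) (hT : 0 ≤ T) (s : ℝ) {F : ℝ → Freq → ℂ}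
    (hF : ∀ k, AEMeasurable (fun t => F t k) (volume.restrict (Ioo 0 T))) {t : ℝ} (ht : t ≤ T) :
    sobolevSq s (fun k => duhamel (heatRate α k) (fun τ => F τ k) t) ≤
      ENNReal.ofReal (1 + T) * energy (s - α) T F := by
  rw [energy_eq_tsum _ hF, ← ENNReal.tsum_mul_left]
  refine ENNReal.tsum_le_tsum fun k => ?_
  set κ := ∫⁻ σ, modeKernel (heatRate α k) T σ
  calc _ ≤ sobolevWeight s k * (κ * ∫⁻ τ in Ioo 0 T, ‖F τ k‖ₑ ^ 2) := by
        gcongr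
        exact enorm_duhamel_sq_le (heatRate_nonneg α k) (hF k) ht
    _ = (sobolevWeight α k * κ) *
        (sobolevWeight (s - α) k * ∫⁻ τ in Ioo 0 T, ‖F τ k‖ₑ ^ 2) := by
        rw [show s = α + (s - α) by ring, sobolevWeight_add, add_sub_cancel_left]
        ring
    _ ≤ _ := by
        gcongr
        exact sobolevWeight_mul_lintegral_modeKernel_le hα hT k

lemma SolvesModes.energy_le {α T : ℝ} (hα : 0 ≤ α) (hT : 0 ≤ T) (s : ℝ) {F a : ℝ → Freq → ℂ}
    (hF : ∀ k, AEMeasurable (fun t => F t k) (volume.restrict (Ioo 0 T)))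
    (ha : ∀ k, AEMeasurable (fun t => a t k) (volume.restrict (Ioo 0 T)))
    (h : SolvesModes α T F a) :
    energy (s + α) T a ≤ ENNReal.ofReal (1 + T) ^ 2 * energy (s - α) T F := by
  rw [energy_eq_tsum _ hF, energy_eq_tsum _ ha, ← ENNReal.tsum_mul_left]
  refine ENNReal.tsum_le_tsum fun k => ?_
  set κ := ∫⁻ σ, modeKernel (heatRate α k) T σ
  calc _ = sobolevWeight (s + α) k *
        ∫⁻ t in Ioo 0 T, ‖duhamel (heatRate α k) (fun τ => F τ k) t‖ₑ ^ 2 := by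
        congr 1
        exact lintegral_congr_ae (h.mono fun t ht => by simp only [ht k])
    _ ≤ sobolevWeight (s + α) k * (κ ^ 2 * ∫⁻ τ in Ioo 0 T, ‖F τ k‖ₑ ^ 2) := by
        gcongr
        exact lintegral_enorm_duhamel_sq_le (hF k)
    _ = (sobolevWeight α k * κ) ^ 2 *
        (sobolevWeight (s - α) k * ∫⁻ τ in Ioo 0 T, ‖F τ k‖ₑ ^ 2) := by
        rw [show s + α = α + α + (s - α) by ring, sobolevWeight_add, sobolevWeight_add]
        ring
    _ ≤ _ := by
        gcongr
        exact sobolevWeight_mul_lintegral_modeKernel_le hα hT k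

lemma SolvesModes.hasParabolicBound {α T : ℝ} (hα : 0 ≤ α) (hT : 0 ≤ T) (s : ℝ)
    {F a : ℝ → Freq → ℂ}
    (hF : ∀ k, AEMeasurable (fun t => F t k) (volume.restrict (Ioo 0 T)))
    (ha : ∀ k, AEMeasurable (fun t => a t k) (volume.restrict (Ioo 0 T)))
    (h : SolvesModes α T F a) :
    HasParabolicBound α s T (ENNReal.ofReal (1 + T) ^ 2 * energy (s - α) T F) a where
  aemeasurable := ha
  energy_le := h.energy_le hα hT s hF ha
  ae_sobolevSq_le := by
    filter_upwards [h, ae_restrict_mem measurableSet_Ioo] with t hat ht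
    have one_le : 1 ≤ ENNReal.ofReal (1 + T) := ENNReal.one_le_ofReal.mpr (by linarith)
    calc sobolevSq s (a t) ≤ ENNReal.ofReal (1 + T) * energy (s - α) T F := by
          rw [funext hat]
          exact sobolevSq_duhamel_le hα hT s hF ht.2.le
      _ ≤ _ := by
          gcongr
          exact le_self_pow one_le two_ne_zero

/-! ### Weak solutions of the ordinary differential equation of a single mode -/

section Primitive

variable {E : Type*} [NormedAddCommGroup E] [NormedSpace ℝ E]

lemma integral_smul_primitive {a b : ℝ} {ψ : ℝ → ℝ} {F : ℝ → E} [CompleteSpace E]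
    (hψ : IntegrableOn ψ (Ioo a b)) (hF : IntegrableOn F (Ioo a b)) :
    ∫ τ in Ioo a b, ψ τ • ∫ t in Ioo a τ, F t =
      ∫ t in Ioo a b, (∫ τ in Ioo t b, ψ τ) • F t := by
  set G : ℝ → ℝ → E := fun τ t => {q : ℝ × ℝ | q.2 < q.1}.indicator (fun q => ψ q.1 • F q.2) (τ, t)
  have hG : Integrable (Function.uncurry G)
      ((volume.restrict (Ioo a b)).prod (volume.restrict (Ioo a b))) :=
    (hψ.smul_prod hF).indicator (measurableSet_lt measurable_snd measurable_fst)
  have inner_left {τ : ℝ} (hτ : τ ∈ Ioo a b) :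
      ψ τ • ∫ t in Ioo a τ, F t = ∫ t in Ioo a b, G τ t := by
    have hGτ : G τ = (Iio τ).indicator fun t => ψ τ • F t := rfl
    rw [hGτ, setIntegral_indicator measurableSet_Iio, Ioo_inter_Iio, min_eq_right hτ.2.le,
      integral_smul]
  have inner_right {t : ℝ} (ht : t ∈ Ioo a b) :
      ∫ τ in Ioo a b, G τ t = (∫ τ in Ioo t b, ψ τ) • F t := by
    have hGt : (G · t) = (Ioi t).indicator fun τ => ψ τ • F t := rfl
    rw [hGt, setIntegral_indicator measurableSet_Ioi, inter_comm, Ioi_inter_Ioo,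
      max_eq_left ht.1.le, integral_smul_const]
  rw [setIntegral_congr_fun measurableSet_Ioo fun τ hτ => inner_left hτ,
    integral_integral_swap hG, setIntegral_congr_fun measurableSet_Ioo fun t ht => inner_right ht]

lemma integrableOn_primitive {a b : ℝ} {F : ℝ → E} (hF : IntegrableOn F (Ioo a b)) :
    IntegrableOn (fun t => ∫ τ in Ioo a t, F τ) (Ioo a b) := by
  have continuousOn := intervalIntegral.continuousOn_primitive
    ((integrableOn_Icc_iff_integrableOn_Ioo).mpr hF)
  simp only [integral_Ioc_eq_integral_Ioo] at continuousOn
  exact continuousOn.integrableOn_Icc.mono_set Ioo_subset_Icc_self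

lemma exists_contDiff_primitive {T : ℝ} {ψ : ℝ → ℝ} (hψ : ContDiff ℝ ∞ ψ)
    (hψc : HasCompactSupport ψ) (hψT : tsupport ψ ⊆ Iio T) :
    ∃ η : ℝ → ℝ, ContDiff ℝ ∞ η ∧ HasCompactSupport η ∧ tsupport η ⊆ Iio T ∧
      ∀ t, 0 < t → deriv η t = -ψ t ∧ η t = ∫ τ in t..T, ψ τ := by
  set P : ℝ → ℝ := fun t => ∫ τ in t..T, ψ τ
  have hasDerivAt_P (t : ℝ) : HasDerivAt P (-ψ t) t :=
    intervalIntegral.integral_hasDerivAt_left (hψ.continuous.intervalIntegrable _ _)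
      hψ.continuous.aestronglyMeasurable.stronglyMeasurableAtFilter hψ.continuous.continuousAt
  have contDiff_P : ContDiff ℝ ∞ P := by
    rw [contDiff_infty_iff_deriv, show deriv P = -ψ from funext fun t => (hasDerivAt_P t).deriv]
    exact ⟨fun t => (hasDerivAt_P t).differentiableAt, hψ.neg⟩
  obtain ⟨b, hbT, hb⟩ : ∃ b < T, ∀ τ, b < τ → ψ τ = 0 := by
    rcases (tsupport ψ).eq_empty_or_nonempty with empty | nonempty
    · exact ⟨T - 1, by linarith, fun τ _ => image_eq_zero_of_notMem_tsupport (by simp [empty])⟩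
    · obtain ⟨b, hbψ, hb⟩ := hψc.isCompact.exists_isGreatest nonempty
      exact ⟨b, hψT hbψ, fun τ hτ => image_eq_zero_of_notMem_tsupport fun h => (hb h).not_gt hτ⟩
  have P_eq_zero {t : ℝ} (ht : b < t) : P t = 0 :=
    intervalIntegral.integral_zero_ae (ae_of_all _ fun τ hτ => hb τ ((lt_min ht hbT).trans hτ.1))
  -- a smooth cutoff at negative times makes the support of the primitive compact
  set η : ℝ → ℝ := fun t => Real.smoothTransition (t + 1) * P t
  have support_η : tsupport η ⊆ Icc (-1) b := by
    refine closure_minimal (Function.support_subset_iff'.mpr fun t ht => ?_) isClosed_Icc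
    rw [mem_Icc, not_and_or, not_le, not_le] at ht
    rcases ht with ht | ht
    · simp only [η, Real.smoothTransition.zero_of_nonpos (by linarith : t + 1 ≤ 0), zero_mul]
    · simp only [η, P_eq_zero ht, mul_zero]
  have η_eventuallyEq {t : ℝ} (ht : 0 < t) : η =ᶠ[𝓝 t] P := by
    filter_upwards [lt_mem_nhds ht] with τ hτ
    simp only [η, Real.smoothTransition.one_of_one_le (by linarith : 1 ≤ τ + 1), one_mul]
  exact ⟨η, (Real.smoothTransition.contDiff.comp (contDiff_id.add contDiff_const)).mul contDiff_P,
    isCompact_Icc.of_isClosed_subset (isClosed_tsupport _) support_η,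
    support_η.trans fun t ht => ht.2.trans_lt hbT,
    fun t ht => ⟨(η_eventuallyEq ht).deriv_eq.trans (hasDerivAt_P t).deriv,
      (η_eventuallyEq ht).eq_of_nhds⟩⟩

lemma ae_eq_primitive_of_weak [CompleteSpace E] {T : ℝ} {a F : ℝ → E}
    (ha : IntegrableOn a (Ioo 0 T)) (hF : IntegrableOn F (Ioo 0 T))
    (weak : ∀ η : ℝ → ℝ, ContDiff ℝ ∞ η → HasCompactSupport η → tsupport η ⊆ Iio T →
      ∫ t in Ioo 0 T, -deriv η t • a t = ∫ t in Ioo 0 T, η t • F t) :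
    ∀ᵐ t ∂volume.restrict (Ioo 0 T), a t = ∫ τ in Ioo 0 t, F τ := by
  set A : ℝ → E := fun t => ∫ τ in Ioo 0 t, F τ
  have hA : IntegrableOn A (Ioo 0 T) := integrableOn_primitive hF
  have key : ∀ᵐ t, t ∈ Ioo 0 T → a t - A t = 0 := by
    refine isOpen_Ioo.ae_eq_zero_of_integral_contDiff_smul_eq_zero
      (ha.sub hA).locallyIntegrableOn fun ψ hψ hψc hψs => ?_
    obtain ⟨η, hη, hηc, hηT, η_spec⟩ :=
      exists_contDiff_primitive hψ hψc (hψs.trans fun t ht => ht.2)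
    rw [← setIntegral_eq_integral_of_forall_compl_eq_zero (s := Ioo 0 T) fun t ht => by
      rw [image_eq_zero_of_notMem_tsupport fun h => ht (hψs h), zero_smul]]
    have integrable_smul {g : ℝ → E} (hg : IntegrableOn g (Ioo 0 T)) :
        IntegrableOn (fun t => ψ t • g t) (Ioo 0 T) :=
      hg.continuousOn_smul_of_subset hψ.continuous.continuousOn isCompact_Icc measurableSet_Ioo
        Ioo_subset_Icc_self
    simp only [smul_sub]
    rw [integral_sub (integrable_smul ha) (integrable_smul hA), sub_eq_zero]
    calc ∫ t in Ioo 0 T, ψ t • a t = ∫ t in Ioo 0 T, -deriv η t • a t :=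
          setIntegral_congr_fun measurableSet_Ioo fun t ht => by
            rw [(η_spec t ht.1).1, neg_neg]
      _ = ∫ t in Ioo 0 T, η t • F t := weak η hη hηc hηT
      _ = ∫ t in Ioo 0 T, (∫ τ in Ioo t T, ψ τ) • F t :=
          setIntegral_congr_fun measurableSet_Ioo fun t ht => by
            rw [(η_spec t ht.1).2, intervalIntegral.integral_of_le ht.2.le,
              integral_Ioc_eq_integral_Ioo]
      _ = ∫ t in Ioo 0 T, ψ t • A t :=
          (integral_smul_primitive (hψ.continuous.integrableOn_Ioc.mono_set Ioo_subset_Ioc_self)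
            hF).symm
  rw [ae_restrict_iff' measurableSet_Ioo]
  filter_upwards [key] with t ht h using sub_eq_zero.mp (ht h)

end Primitive

lemma duhamel_eq (lam : ℝ) (F : ℝ → ℂ) (t : ℝ) :
    duhamel lam F t =
      Real.exp (-(lam * t)) • ∫ τ in Ioo 0 t, Real.exp (lam * τ) • F τ := by
  rw [duhamel, ← integral_smul]
  refine integral_congr_ae (ae_of_all _ fun τ => ?_)
  simp only [smul_smul, ← Real.exp_add]
  rw [Complex.real_smul, show -(lam * t) + lam * τ = -(lam * (t - τ)) by ring]

lemma ae_eq_duhamel_of_weak (lam : ℝ) {T : ℝ} {a F : ℝ → ℂ}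
    (ha : IntegrableOn a (Ioo 0 T)) (hF : IntegrableOn F (Ioo 0 T))
    (weak : ∀ η : ℝ → ℝ, ContDiff ℝ ∞ η → HasCompactSupport η → tsupport η ⊆ Iio T →
      ∫ t in Ioo 0 T, (-deriv η t + lam * η t) • a t = ∫ t in Ioo 0 T, η t • F t) :
    ∀ᵐ t ∂volume.restrict (Ioo 0 T), a t = duhamel lam F t := by
  have hexp : ContDiff ℝ ∞ fun t => Real.exp (lam * t) := by fun_prop
  have integrableOn_exp_smul {g : ℝ → ℂ} (hg : IntegrableOn g (Ioo 0 T)) :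
      IntegrableOn (fun t => Real.exp (lam * t) • g t) (Ioo 0 T) :=
    hg.continuousOn_smul_of_subset hexp.continuous.continuousOn isCompact_Icc measurableSet_Ioo
      Ioo_subset_Icc_self
  -- the integrating factor `exp (lam t)` reduces to the case `lam = 0`
  have key := ae_eq_primitive_of_weak (integrableOn_exp_smul ha) (integrableOn_exp_smul hF)
    fun η hη hηc hηT => by
      have hasDerivAt (t : ℝ) : HasDerivAt (fun t => η t * Real.exp (lam * t))
          (deriv η t * Real.exp (lam * t) + η t * (Real.exp (lam * t) * lam)) t :=
        (hη.differentiable (by simp) t).hasDerivAt.mul (hasDerivAt_const_mul lam).exp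
      have := weak (fun t => η t * Real.exp (lam * t)) (hη.mul hexp) hηc.mul_right
        ((tsupport_mul_subset_left).trans hηT)
      simp only [(hasDerivAt _).deriv] at this
      convert this using 3 with t
      · rw [smul_smul]
        congr 1
        ring
      · rw [smul_smul]
  filter_upwards [key] with t ht
  rw [duhamel_eq, ← ht, smul_smul, ← Real.exp_add, neg_add_cancel, Real.exp_zero, one_smul]

/-! ### Fourier modes on the torus -/

open UnitAddTorus ComplexConjugate

section Modes

variable {d : Type*} [Fintype d] (k : d → ℤ)

lemma norm_mFourier_apply (x : UnitAddTorus d) : ‖mFourier k x‖ = 1 := by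
  simp only [mFourier, ContinuousMap.coe_mk, fourier_apply, norm_prod, Circle.norm_coe,
    Finset.prod_const_one]

lemma mFourier_add_apply (x y : UnitAddTorus d) :
    mFourier k (x + y) = mFourier k x * mFourier k y := by
  simp only [mFourier, ContinuousMap.coe_mk, Pi.add_apply, fourier_apply, smul_add,
    AddCircle.toCircle_add, Circle.coe_mul, Finset.prod_mul_distrib]

variable [DecidableEq d]

lemma mFourier_single_apply (j : d) (h : UnitAddCircle) :
    mFourier k (Pi.single j h) = fourier (k j) h := by
  simp only [mFourier, ContinuousMap.coe_mk]
  rw [Finset.prod_eq_single j (fun i _ hij => by rw [Pi.single_eq_of_ne hij, fourier_eval_zero])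
    (fun hj => absurd (Finset.mem_univ j) hj), Pi.single_eq_same]

lemma hasDerivAt_mFourier_single (j : d) :
    HasDerivAt (fun h : ℝ => mFourier k (Pi.single j (h : UnitAddCircle)))
      (2 * Real.pi * Complex.I * k j) 0 := by
  simp only [mFourier_single_apply]
  simpa using hasDerivAt_fourier 1 (k j) 0

end Modes

lemma smooth_mFourier (k : Freq) : ContDiff ℝ ∞ fun y : Fin 2 → ℝ => mFourier k (toTorus y) := by
  simp only [mFourier, ContinuousMap.coe_mk, toTorus, fourier_coe_apply]
  exact contDiff_prod fun i _ => (((contDiff_const.mul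
    (Complex.ofRealCLM.contDiff.comp (contDiff_apply ℝ ℝ i))).div_const _)).cexp

lemma integral_mFourier (k : Freq) : ∫ x, mFourier k x ∂torusMeasure = if k = 0 then 1 else 0 := by
  have := orthonormal_iff_ite.mp (orthonormal_mFourier (d := Fin 2)) 0 k
  simp only [ContinuousMap.inner_toLp, mFourier_zero, ContinuousMap.one_apply, map_one, mul_one,
    eq_comm (a := (0 : Freq))] at this
  exact this

lemma torusCoeff_eq (g : Torus → ℝ) (k : Freq) :
    torusCoeff g k = ∫ x, mFourier (-k) x * (g x : ℂ) ∂torusMeasure := rfl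

lemma integrable_mFourier_mul {g : Torus → ℂ} (hg : Integrable g torusMeasure) (k : Freq) :
    Integrable (fun x => mFourier k x * g x) torusMeasure :=
  hg.bdd_mul (c := 1) (by fun_prop) (ae_of_all _ fun x => (norm_mFourier_apply k x).le)

lemma torusCoeff_add {g h : Torus → ℝ} (hg : Integrable g torusMeasure)
    (hh : Integrable h torusMeasure) :
    torusCoeff (fun x => g x + h x) = torusCoeff g + torusCoeff h := by
  ext k
  simp only [torusCoeff_eq, Pi.add_apply, Complex.ofReal_add, mul_add]
  exact integral_add (integrable_mFourier_mul hg.ofReal _) (integrable_mFourier_mul hh.ofReal _)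

lemma torusCoeff_const_mul (r : ℝ) (g : Torus → ℝ) :
    torusCoeff (fun x => r * g x) = (r : ℂ) • torusCoeff g := by
  ext k
  simp only [torusCoeff_eq, Pi.smul_apply, smul_eq_mul, Complex.ofReal_mul, mul_left_comm _ (r : ℂ),
    integral_const_mul]

lemma fracLaplacian_const_mul (α r : ℝ) (g : Torus → ℝ) (x : Torus) :
    fracLaplacian α (fun y => r * g y) x = r * fracLaplacian α g x := by
  simp only [fracLaplacian, torusCoeff_const_mul, Pi.smul_apply, smul_eq_mul,
    mul_left_comm _ (r : ℂ), mul_assoc, tsum_mul_left, Complex.re_ofReal_mul]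

/-- The real trigonometric polynomial `Re (c e^{2πi k·x})`, used as a test function. -/
def realMode (c : ℂ) (k : Freq) (x : Torus) : ℝ := (c * mFourier k x).re

lemma smoothOnTorus_realMode (c : ℂ) (k : Freq) : SmoothOnTorus (realMode c k) :=
  Complex.reCLM.contDiff.comp (contDiff_const.mul (smooth_mFourier k))

lemma partialDeriv_realMode (j : Fin 2) (c : ℂ) (k : Freq) (x : Torus) :
    partialDeriv j (realMode c k) x = realMode (2 * Real.pi * Complex.I * k j * c) k x := by
  have hderiv : HasDerivAt (fun h : ℝ => c * mFourier k (x + Pi.single j (h : UnitAddCircle)))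
      (2 * Real.pi * Complex.I * k j * c * mFourier k x) 0 := by
    simp only [mFourier_add_apply]
    exact (((hasDerivAt_mFourier_single k j).const_mul _).const_mul c).congr_deriv (by ring)
  exact (Complex.reCLM.hasFDerivAt.comp_hasDerivAt _ hderiv).deriv

lemma integral_re_mul {β : Type*} [MeasurableSpace β] {μ : Measure β} {φ : β → ℝ} {g : β → ℂ}
    (h : Integrable (fun t => φ t • g t) μ) (c : ℂ) :
    ∫ t, φ t * (c * g t).re ∂μ = (c * ∫ t, φ t • g t ∂μ).re := by
  rw [← integral_const_mul, ← RCLike.re_to_complex, ← integral_re (h.const_mul c)]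
  refine integral_congr_ae (ae_of_all _ fun t => ?_)
  simp only [RCLike.re_to_complex, Complex.real_smul]
  rw [mul_left_comm, Complex.re_ofReal_mul]

lemma integral_mul_realMode {g : Torus → ℝ} (hg : Integrable g torusMeasure) (c : ℂ) (k : Freq) :
    ∫ x, g x * realMode c (-k) x ∂torusMeasure = (c * torusCoeff g k).re := by
  have smul_eq (x : Torus) : g x • mFourier (-k) x = mFourier (-k) x * g x := by
    rw [Complex.real_smul, mul_comm]
  simp only [realMode]
  rw [integral_re_mul (by simp only [smul_eq]; exact integrable_mFourier_mul hg.ofReal (-k)),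
    torusCoeff_eq]
  simp only [smul_eq]

lemma torusCoeff_realMode (c : ℂ) (k m : Freq) :
    torusCoeff (realMode c k) m =
      (if m = k then c / 2 else 0) + if m = -k then conj c / 2 else 0 := by
  have integrable_mFourier (n : Freq) : Integrable (fun x => mFourier n x) torusMeasure :=
    (mFourier n).continuous.integrable_of_hasCompactSupport (HasCompactSupport.of_compactSpace _)
  have decomposition (x : Torus) : mFourier (-m) x * (realMode c k x : ℂ) =
      c / 2 * mFourier (-m + k) x + conj c / 2 * mFourier (-m + -k) x := by
    rw [realMode, Complex.re_eq_add_conj, map_mul, mFourier_add, mFourier_add,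
      mFourier_neg (n := k)]
    ring
  simp only [torusCoeff_eq, decomposition]
  rw [integral_add ((integrable_mFourier _).const_mul _) ((integrable_mFourier _).const_mul _)]
  simp only [integral_const_mul, integral_mFourier, neg_add_eq_zero, mul_ite, mul_one, mul_zero]

lemma heatRate_neg (α : ℝ) (k : Freq) : heatRate α (-k) = heatRate α k := by
  simp only [heatRate, freqNorm, Pi.neg_apply, Int.cast_neg, neg_sq]

lemma fracLaplacian_realMode (α : ℝ) (c : ℂ) (k : Freq) (x : Torus) :
    fracLaplacian α (realMode c k) x = heatRate α k * realMode c k x := by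
  have hasSum : HasSum (fun m : Freq => (((2 * Real.pi * freqNorm m) ^ (2 * α) : ℝ) : ℂ) *
      torusCoeff (realMode c k) m * mFourier m x)
      ((heatRate α k : ℂ) * (c / 2) * mFourier k x +
        (heatRate α k : ℂ) * (conj c / 2) * mFourier (-k) x) := by
    refine ((hasSum_ite_eq k ((heatRate α k : ℂ) * (c / 2) * mFourier k x)).add
      (hasSum_ite_eq (-k) ((heatRate α k : ℂ) * (conj c / 2) * mFourier (-k) x))).congr_fun
        fun m => ?_
    rw [torusCoeff_realMode, ← heatRate, mul_add, add_mul]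
    congr 1
    · split_ifs with hm
      · rw [hm]
      · rw [mul_zero, zero_mul]
    · split_ifs with hm
      · rw [hm, heatRate_neg]
      · rw [mul_zero, zero_mul]
  rw [fracLaplacian, hasSum.tsum_eq, ← Complex.ofReal_re (heatRate α k * realMode c k x),
    Complex.ofReal_mul, realMode, Complex.re_eq_add_conj, map_mul, mFourier_neg]
  congr 1
  ring

lemma isTestFunction_mul {I : Set ℝ} {η : ℝ → ℝ} (hη : ContDiff ℝ ∞ η) (hηc : HasCompactSupport η)
    (hηI : tsupport η ⊆ I) {g : Torus → ℝ} (hg : SmoothOnTorus g) :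
    IsTestFunction I fun t x => η t * g x := by
  have tsupport_subset : tsupport (Function.uncurry fun t x => η t * g x) ⊆
      tsupport η ×ˢ (univ : Set Torus) :=
    closure_minimal (fun p hp => ⟨subset_tsupport η (left_ne_zero_of_mul hp), trivial⟩)
      ((isClosed_tsupport η).prod isClosed_univ)
  exact ⟨(hη.comp contDiff_fst).mul (hg.comp contDiff_snd),
    (hηc.isCompact.prod isCompact_univ).of_isClosed_subset (isClosed_tsupport _) tsupport_subset,
    tsupport_subset.trans (prod_mono hηI subset_rfl)⟩

/-! ### The weak formulation on the Fourier side -/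

lemma eq_of_forall_re_mul_eq {z w : ℂ} (h : ∀ c : ℂ, (c * z).re = (c * w).re) : z = w :=
  Complex.ext (by simpa using h 1) (by simpa using h (-Complex.I))

lemma integrable_L2Torus (g : L2Torus) : Integrable g torusMeasure :=
  (Lp.memLp g).integrable one_le_two

section WeakFormulation

variable {α T : ℝ} {F : ℝ → Torus → ℝ} {v : ℝ → L2Torus}

lemma SolvesWeakly.integral_re_mul_torusCoeff (h : SolvesWeakly α T F v)
    (hF : ∀ᵐ t ∂volume.restrict (Ioo 0 T), Integrable (F t) torusMeasure)
    {η : ℝ → ℝ} (hη : ContDiff ℝ ∞ η) (hηc : HasCompactSupport η) (hηT : tsupport η ⊆ Iio T)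
    (c : ℂ) (k : Freq) :
    ∫ t in Ioo 0 T, (-deriv η t + heatRate α k * η t) * (c * torusCoeff (v t) k).re =
      ∫ t in Ioo 0 T, η t * (c * torusCoeff (F t) k).re := by
  have weak := h _ (isTestFunction_mul hη hηc hηT (smoothOnTorus_realMode c (-k)))
  convert weak using 1
  · refine integral_congr_ae (ae_of_all _ fun t => ?_)
    simp only
    rw [← integral_mul_realMode (integrable_L2Torus (v t)), ← integral_const_mul]
    refine integral_congr_ae (ae_of_all _ fun x => ?_)
    simp only
    rw [fracLaplacian_const_mul, fracLaplacian_realMode, heatRate_neg,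
      deriv_mul_const ((hη.differentiable (by simp)) t)]
    ring
  · refine integral_congr_ae ?_
    filter_upwards [hF] with t ht
    rw [← integral_mul_realMode ht, ← integral_const_mul]
    exact integral_congr_ae (ae_of_all _ fun x => mul_left_comm _ _ _)

lemma SolvesWeakly.torusCoeff_eq_duhamel (h : SolvesWeakly α T F v)
    (hF : ∀ᵐ t ∂volume.restrict (Ioo 0 T), Integrable (F t) torusMeasure) (k : Freq)
    (hvk : IntegrableOn (fun t => torusCoeff (v t) k) (Ioo 0 T))
    (hFk : IntegrableOn (fun t => torusCoeff (F t) k) (Ioo 0 T)) :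
    ∀ᵐ t ∂volume.restrict (Ioo 0 T),
      torusCoeff (v t) k = duhamel (heatRate α k) (fun τ => torusCoeff (F τ) k) t := by
  refine ae_eq_duhamel_of_weak _ hvk hFk fun η hη hηc hηT => eq_of_forall_re_mul_eq fun c => ?_
  have integrableOn_smul {φ : ℝ → ℝ} {g : ℝ → ℂ} (hφ : Continuous φ)
      (hg : IntegrableOn g (Ioo 0 T)) : IntegrableOn (fun t => φ t • g t) (Ioo 0 T) :=
    hg.continuousOn_smul_of_subset hφ.continuousOn isCompact_Icc measurableSet_Ioo
      Ioo_subset_Icc_self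
  have hη' : Continuous fun t => -deriv η t + heatRate α k * η t :=
    (hη.continuous_deriv (by simp)).neg.add (continuous_const.mul hη.continuous)
  rw [← integral_re_mul (integrableOn_smul hη' hvk),
    ← integral_re_mul (integrableOn_smul hη.continuous hFk)]
  exact h.integral_re_mul_torusCoeff hF hη hηc hηT c k

end WeakFormulation

/-! ### Uniqueness of Fourier coefficients -/

lemma ae_eq_zero_of_forall_integral_boundedContinuous_smul {X E : Type*} [TopologicalSpace X]
    [HasOuterApproxClosed X] [MeasurableSpace X] [BorelSpace X] [NormedAddCommGroup E]
    [NormedSpace ℝ E] [CompleteSpace E] {μ : Measure X} {g : X → E} (hg : Integrable g μ)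
    (h : ∀ φ : BoundedContinuousFunction X ℝ, ∫ x, φ x • g x ∂μ = 0) : g =ᵐ[μ] 0 := by
  refine ae_eq_zero_of_forall_setIntegral_isClosed_eq_zero hg fun s hs => ?_
  -- the indicator of `s` is the limit of a bounded sequence of continuous functions
  let φ (n : ℕ) : BoundedContinuousFunction X ℝ :=
    BoundedContinuousFunction.comp ((↑) : ℝ≥0 → ℝ) NNReal.isometry_coe.lipschitz (hs.apprSeq n)
  have tendsto_integral : Tendsto (fun n => ∫ x, φ n x • g x ∂μ) atTop
      (𝓝 (∫ x, s.indicator g x ∂μ)) := by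
    refine tendsto_integral_of_dominated_convergence (fun x => ‖g x‖)
      (fun n => (φ n).continuous.aestronglyMeasurable.smul hg.aestronglyMeasurable) hg.norm
      (fun n => ae_of_all _ fun x => ?_) (ae_of_all _ fun x => ?_)
    · rw [norm_smul]
      refine mul_le_of_le_one_left (norm_nonneg _) ?_
      exact (Real.norm_of_nonneg (hs.apprSeq n x).coe_nonneg).trans_le
        (HasOuterApproxClosed.apprSeq_apply_le_one hs n x)
    · have tendsto_apprSeq := (NNReal.continuous_coe.tendsto _).comp
        (tendsto_pi_nhds.mp (HasOuterApproxClosed.tendsto_apprSeq hs) x)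
      have indicator_eq : s.indicator g x = (s.indicator (fun _ => 1) x : ℝ≥0) • g x := by
        by_cases hx : x ∈ s <;> simp [hx]
      rw [indicator_eq]
      exact tendsto_apprSeq.smul_const (g x)
  simp only [h] at tendsto_integral
  rw [← integral_indicator hs.measurableSet]
  exact (tendsto_nhds_unique tendsto_const_nhds tendsto_integral).symm

lemma ae_eq_zero_of_forall_integral_mFourier_smul {d E : Type*} [Fintype d] [NormedAddCommGroup E]
    [NormedSpace ℂ E] [CompleteSpace E] {μ : Measure (UnitAddTorus d)} {g : UnitAddTorus d → E}
    (hg : Integrable g μ) (h : ∀ k, ∫ x, mFourier k x • g x ∂μ = 0) : g =ᵐ[μ] 0 := by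
  have integrable_smul (φ : C(UnitAddTorus d, ℂ)) : Integrable (fun x => φ x • g x) μ :=
    hg.bdd_smul ‖φ‖ φ.continuous.aestronglyMeasurable (ae_of_all _ φ.norm_coe_le_norm)
  let pairing : C(UnitAddTorus d, ℂ) →L[ℂ] E := LinearMap.mkContinuous
    { toFun := fun φ => ∫ x, φ x • g x ∂μ
      map_add' := fun φ ψ => by
        simp only [ContinuousMap.add_apply, add_smul]
        exact integral_add (integrable_smul φ) (integrable_smul ψ)
      map_smul' := fun c φ => by
        simp only [ContinuousMap.smul_apply, smul_assoc, RingHom.id_apply]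
        exact integral_smul c _ }
    (∫ x, ‖g x‖ ∂μ) fun φ => by
      simp only [LinearMap.coe_mk, AddHom.coe_mk]
      rw [mul_comm, ← integral_const_mul]
      refine norm_integral_le_of_norm_le (hg.norm.const_mul _) (ae_of_all _ fun x => ?_)
      rw [norm_smul]
      gcongr
      exact φ.norm_coe_le_norm x
  have pairing_eq_zero : pairing = 0 := by
    refine ContinuousLinearMap.ext_on
      (Submodule.dense_iff_topologicalClosure_eq_top.mpr span_mFourier_closure_eq_top) ?_
    rintro _ ⟨k, rfl⟩
    exact h k
  refine ae_eq_zero_of_forall_integral_boundedContinuous_smul hg fun φ => ?_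
  exact DFunLike.congr_fun pairing_eq_zero
    ⟨fun x => (φ x : ℂ), Complex.continuous_ofReal.comp φ.continuous⟩

section FourierSeries

variable {u : Torus → ℝ}

lemma continuous_tsum_mFourier {a : Freq → ℂ} (ha : Summable fun k => ‖a k‖) :
    Continuous fun x => ∑' k, a k * mFourier k x :=
  continuous_tsum (fun k => by fun_prop) ha fun k x => by
    rw [norm_mul, norm_mFourier_apply, mul_one]

lemma integral_mFourier_mul_tsum {a : Freq → ℂ} (ha : Summable fun k => ‖a k‖) (m : Freq) :
    ∫ x, mFourier m x * ∑' k, a k * mFourier k x ∂torusMeasure = a (-m) := by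
  have integral_term (k : Freq) : ∫ x, mFourier m x * (a k * mFourier k x) ∂torusMeasure =
      if k = -m then a (-m) else 0 := by
    simp only [mul_left_comm _ (a k), ← mFourier_add]
    rw [integral_const_mul, integral_mFourier, mul_ite, mul_one, mul_zero]
    have : m + k = 0 ↔ k = -m := by rw [add_comm, add_eq_zero_iff_eq_neg]
    simp only [this]
    split_ifs with hk
    · rw [hk]
    · rfl
  have hasSum := hasSum_integral_of_summable_integral_norm (μ := torusMeasure)
    (F := fun (k : Freq) x => mFourier m x * (a k * mFourier k x))
    (fun k => Continuous.integrable_of_hasCompactSupport (by fun_prop)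
      (HasCompactSupport.of_compactSpace _))
    (by simpa [norm_mFourier_apply] using ha)
  simp only [integral_term, tsum_mul_left] at hasSum
  exact hasSum.unique (hasSum_ite_eq (-m) _)

lemma ae_eq_tsum_mFourier (hu : Integrable u torusMeasure)
    (hs : Summable fun k => ‖torusCoeff u k‖) :
    ∀ᵐ x ∂torusMeasure, (u x : ℂ) = ∑' k, torusCoeff u k * mFourier k x := by
  have integrable_series :
      Integrable (fun x => ∑' k, torusCoeff u k * mFourier k x) torusMeasure :=
    (continuous_tsum_mFourier hs).integrable_of_hasCompactSupport
      (HasCompactSupport.of_compactSpace _)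
  have ae_sub := ae_eq_zero_of_forall_integral_mFourier_smul (hu.ofReal.sub integrable_series)
    fun m => by
      simp only [Pi.sub_apply, smul_eq_mul, mul_sub]
      rw [integral_sub (integrable_mFourier_mul hu.ofReal m)
        (integrable_mFourier_mul integrable_series m), integral_mFourier_mul_tsum hs, sub_eq_zero,
        torusCoeff_eq, neg_neg]
      rfl
  filter_upwards [ae_sub] with x hx using sub_eq_zero.mp hx

lemma integrable_mul_of_summable_torusCoeff {G : Torus → ℝ} (hu : Integrable u torusMeasure)
    (hs : Summable fun k => ‖torusCoeff u k‖) (hG : Integrable G torusMeasure) :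
    Integrable (fun x => u x * G x) torusMeasure := by
  refine hG.bdd_mul (c := ∑' k, ‖torusCoeff u k‖) hu.aestronglyMeasurable ?_
  filter_upwards [ae_eq_tsum_mFourier hu hs] with x hx
  have norm_term (k : Freq) : ‖torusCoeff u k * mFourier k x‖ = ‖torusCoeff u k‖ := by
    rw [norm_mul, norm_mFourier_apply, mul_one]
  rw [← Complex.norm_real, hx]
  simpa only [norm_term] using
    norm_tsum_le_tsum_norm (f := fun k => torusCoeff u k * mFourier k x) (by simpa only [norm_term])

lemma hasSum_torusCoeff_mul {G : Torus → ℝ} (hu : Integrable u torusMeasure)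
    (hs : Summable fun k => ‖torusCoeff u k‖) (hG : Integrable G torusMeasure) (k : Freq) :
    HasSum (fun l => torusCoeff u l * torusCoeff G (k - l))
      (torusCoeff (fun x => u x * G x) k) := by
  have hasSum := hasSum_integral_of_summable_integral_norm (μ := torusMeasure)
    (F := fun (l : Freq) x => torusCoeff u l * (mFourier (-(k - l)) x * (G x : ℂ)))
    (fun l => (integrable_mFourier_mul hG.ofReal _).const_mul _)
    (by
      simp only [norm_mul, norm_mFourier_apply, one_mul, integral_const_mul]
      exact hs.mul_right _)
  simp only [integral_const_mul, ← torusCoeff_eq G] at hasSum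
  suffices torusCoeff (fun x => u x * G x) k =
      ∫ x, ∑' l, torusCoeff u l * (mFourier (-(k - l)) x * (G x : ℂ)) ∂torusMeasure by
    rwa [this]
  rw [torusCoeff_eq]
  refine integral_congr_ae ?_
  filter_upwards [ae_eq_tsum_mFourier hu hs] with x hx
  rw [Complex.ofReal_mul, hx, ← mul_assoc, ← tsum_mul_left, ← tsum_mul_right]
  refine tsum_congr fun l => ?_
  rw [show -(k - l) = -k + l by abel, mFourier_add]
  ring

end FourierSeries

/-! ### The transport term -/

lemma IsWeakPartial.torusCoeff_eq {j : Fin 2} {g v : Torus → ℝ} (h : IsWeakPartial j g v)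
    (k : Freq) : torusCoeff v k = 2 * Real.pi * Complex.I * k j * torusCoeff g k := by
  obtain ⟨hg, hv, weak⟩ := h
  refine eq_of_forall_re_mul_eq fun c => ?_
  have := weak _ (smoothOnTorus_realMode c (-k))
  simp only [partialDeriv_realMode] at this
  rw [integral_mul_realMode hg, integral_mul_realMode hv] at this
  rw [← neg_eq_iff_eq_neg.mpr this, ← Complex.neg_re, Pi.neg_apply, Int.cast_neg]
  congr 1
  ring

lemma torusCoeff_kernelConv {K g : Torus → ℝ} (hK : Integrable K torusMeasure)
    (hg : Integrable g torusMeasure) (k : Freq) :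
    torusCoeff (kernelConv K g) k = torusCoeff K k * torusCoeff g k := by
  have mFourier_split (x y : Torus) :
      mFourier (-k) x = mFourier (-k) y * mFourier (-k) (x - y) := by
    rw [← mFourier_add_apply, add_sub_cancel]
  have := integral_convolution (μ := torusMeasure) (ν := torusMeasure)
    (ContinuousLinearMap.mul ℝ ℂ) (integrable_mFourier_mul hg.ofReal (-k))
    (integrable_mFourier_mul hK.ofReal (-k))
  refine Eq.trans ?_ (this.trans (mul_comm _ _))
  rw [torusCoeff_eq]
  refine integral_congr_ae (ae_of_all _ fun x => ?_)
  simp only [kernelConv, convolution, ContinuousLinearMap.mul_apply']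
  rw [← integral_complex_ofReal, ← integral_const_mul]
  refine integral_congr_ae (ae_of_all _ fun y => ?_)
  simp only [Complex.ofReal_mul, mFourier_split x y, Complex.coe_algebraMap]
  ring

/-- The rotation `(k₁, k₂) ↦ (-k₂, k₁)`, the symbol of `(-∂₂, ∂₁)` up to the factor `2πi`. -/
def perp (k : Freq) : Freq := ![-k 1, k 0]

lemma freqNorm_perp (k : Freq) : freqNorm (perp k) = freqNorm k := by
  simp [freqNorm, perp, add_comm]

/-- The symbol of the bilinear operator `(θ, η) ↦ ℛθ · ∇η`. -/
def transportSymbol (K : Torus → ℝ) (k l : Freq) : ℂ :=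
  (2 * Real.pi * Complex.I) ^ 2 * torusCoeff K l * ∑ j, (perp l j : ℂ) * (k - l) j

/-- The Fourier coefficients of `ℛθ · ∇θ` in terms of those of `θ`. -/
def transportCoeff (K : Torus → ℝ) (a : Freq → ℂ) (k : Freq) : ℂ :=
  ∑' l, transportSymbol K k l * a l * a (k - l)

lemma norm_intCast_le_freqNorm (k : Freq) (j : Fin 2) : ‖(k j : ℂ)‖ ≤ freqNorm k := by
  rw [Complex.norm_intCast]
  exact abs_coord_le_freqNorm k j

lemma enorm_freqNorm_le_sobolevWeight (k : Freq) :
    ENNReal.ofReal (freqNorm k) ≤ sobolevWeight (1 / 2) k := by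
  refine ENNReal.ofReal_le_ofReal ?_
  rw [← Real.sqrt_eq_rpow]
  exact Real.le_sqrt_of_sq_le (le_add_of_nonneg_left zero_le_one)

lemma norm_two_pi_I : ‖(2 * Real.pi * Complex.I : ℂ)‖ = 2 * Real.pi := by
  simp [abs_of_pos Real.pi_pos]

/-- The nonlinearity `N` on Fourier coefficients satisfies
`‖N(a)‖²_{H^{s-α}} ≤ B ‖a‖²_{H^s} ‖a‖²_{H^{s+α}}`. -/
def HasQuadraticBound (α s : ℝ) (B : ℝ≥0∞) (N : (Freq → ℂ) → Freq → ℂ) : Prop :=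
  ∀ a, sobolevSq (s - α) (N a) ≤ B * (sobolevSq s a * sobolevSq (s + α) a)

section Kernel

variable {K : Torus → ℝ} {C : ℝ}

lemma IsAdmissibleKernel.exists_norm_torusCoeff_mul_freqNorm_le (hK : IsAdmissibleKernel K) :
    ∃ C : ℝ, ∀ k, ‖torusCoeff K k‖ * freqNorm k ≤ C := by
  obtain ⟨c, C, hc, hC, bounds⟩ := hK.coeff_bounds
  refine ⟨C, fun k => ?_⟩
  rcases eq_or_ne k 0 with rfl | hk
  · rw [freqNorm_zero, mul_zero]
    exact hC.le
  · obtain ⟨im_eq_zero, le_re, re_le⟩ := bounds k hk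
    have freqNorm_pos : 0 < freqNorm k := one_pos.trans_le (one_le_freqNorm hk)
    rw [← Complex.abs_re_eq_norm.mpr im_eq_zero, ← le_div_iff₀ freqNorm_pos, div_eq_mul_inv,
      abs_of_nonneg (le_trans (by positivity) le_re)]
    exact re_le

lemma enorm_transportSymbol_le (hK : ∀ k, ‖torusCoeff K k‖ * freqNorm k ≤ C) (k l : Freq) :
    ‖transportSymbol K k l‖ₑ ≤
      ENNReal.ofReal ((2 * Real.pi) ^ 2 * (2 * C)) * sobolevWeight (1 / 2) (k - l) := by
  have hC : 0 ≤ C := by simpa only [freqNorm_zero, mul_zero] using hK 0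
  have norm_le : ‖transportSymbol K k l‖ ≤ (2 * Real.pi) ^ 2 * (2 * C) * freqNorm (k - l) := by
    calc ‖transportSymbol K k l‖
        ≤ (2 * Real.pi) ^ 2 * ‖torusCoeff K l‖ * ∑ j, ‖(perp l j : ℂ) * (k - l) j‖ := by
          rw [transportSymbol, norm_mul, norm_mul, norm_pow, norm_two_pi_I]
          gcongr
          exact norm_sum_le _ _
      _ ≤ (2 * Real.pi) ^ 2 * ‖torusCoeff K l‖ *
            ∑ _j : Fin 2, freqNorm l * freqNorm (k - l) := by
          gcongr with j
          rw [norm_mul, ← freqNorm_perp l]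
          exact mul_le_mul (norm_intCast_le_freqNorm _ j) (norm_intCast_le_freqNorm _ j)
            (norm_nonneg _) (freqNorm_nonneg _)
      _ = (2 * Real.pi) ^ 2 * (2 * (‖torusCoeff K l‖ * freqNorm l)) * freqNorm (k - l) := by
          rw [Fin.sum_univ_two]
          ring
      _ ≤ (2 * Real.pi) ^ 2 * (2 * C) * freqNorm (k - l) := by
          gcongr
          · exact freqNorm_nonneg _
          · exact hK l
  calc ‖transportSymbol K k l‖ₑ
      ≤ ENNReal.ofReal ((2 * Real.pi) ^ 2 * (2 * C) * freqNorm (k - l)) := by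
        rw [← ofReal_norm]
        exact ENNReal.ofReal_le_ofReal norm_le
    _ ≤ _ := by
        rw [ENNReal.ofReal_mul (by positivity)]
        gcongr
        exact enorm_freqNorm_le_sobolevWeight _

lemma exists_hasQuadraticBound_transportCoeff {α s : ℝ} (hα : 1 / 2 ≤ α) (hαs : α ≤ s)
    (hs : 2 < s + α) (hK : ∀ k, ‖torusCoeff K k‖ * freqNorm k ≤ C) :
    ∃ B : ℝ≥0∞, B ≠ ⊤ ∧ HasQuadraticBound α s B (transportCoeff K) := by
  obtain ⟨D, hD, product_le⟩ := exists_sobolevSq_mul_deriv_le hα hαs hs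
  set c := ENNReal.ofReal ((2 * Real.pi) ^ 2 * (2 * C))
  refine ⟨c ^ 2 * D, by finiteness, fun a => ?_⟩
  set A : Freq → ℝ≥0∞ := fun k => ‖a k‖ₑ
  have enorm_le (k : Freq) : ‖transportCoeff K a k‖ₑ ≤
      c * (A ⋆ₗ[Measure.count] fun l => sobolevWeight (1 / 2) l * A l) k := by
    rw [lconvolution_def, lintegral_count, ← ENNReal.tsum_mul_left]
    refine enorm_tsum_le_tsum_enorm.trans (ENNReal.tsum_le_tsum fun l => ?_)
    rw [enorm_mul, enorm_mul, neg_add_eq_sub]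
    calc ‖transportSymbol K k l‖ₑ * ‖a l‖ₑ * ‖a (k - l)‖ₑ
        ≤ (c * sobolevWeight (1 / 2) (k - l)) * ‖a l‖ₑ * ‖a (k - l)‖ₑ := by
          gcongr
          exact enorm_transportSymbol_le hK k l
      _ = _ := by ring
  calc sobolevSq (s - α) (transportCoeff K a)
      ≤ c ^ 2 * sobolevSq (s - α) (A ⋆ₗ[Measure.count] fun l => sobolevWeight (1 / 2) l * A l) := by
        simp only [sobolevSq, ← ENNReal.tsum_mul_left, mul_left_comm (c ^ 2), ← mul_pow]
        gcongr with k
        exact enorm_le k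
    _ ≤ c ^ 2 * (D * (sobolevSq s A * sobolevSq (s + α) A)) := by
        gcongr
        exact product_le A
    _ = c ^ 2 * D * (sobolevSq s a * sobolevSq (s + α) a) := by
        rw [mul_assoc]
        rfl

variable {g : Torus → ℝ} {u : Fin 2 → Torus → ℝ}

lemma IsVelocity.integrable (hu : IsVelocity K g u) (j : Fin 2) :
    Integrable (u j) torusMeasure := by
  fin_cases j
  · simpa using hu.1.2.1.neg
  · exact hu.2.2.1

lemma IsVelocity.torusCoeff_eq (hK : Integrable K torusMeasure) (hg : Integrable g torusMeasure)
    (hu : IsVelocity K g u) (j : Fin 2) (k : Freq) :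
    torusCoeff (u j) k =
      2 * Real.pi * Complex.I * perp k j * (torusCoeff K k * torusCoeff g k) := by
  rw [← torusCoeff_kernelConv hK hg k]
  fin_cases j
  · have := congrFun (torusCoeff_const_mul (-1) fun x => -u 0 x) k
    simp only [neg_mul, one_mul, neg_neg, Pi.smul_apply, hu.1.torusCoeff_eq k] at this
    simpa [perp] using this
  · simpa [perp] using hu.2.torusCoeff_eq k

lemma IsVelocity.summable_norm_torusCoeff (hK : Integrable K torusMeasure)
    (hKC : ∀ k, ‖torusCoeff K k‖ * freqNorm k ≤ C) (hg : Integrable g torusMeasure)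
    (hs : Summable fun k => ‖torusCoeff g k‖) (hu : IsVelocity K g u) (j : Fin 2) :
    Summable fun k => ‖torusCoeff (u j) k‖ := by
  refine Summable.of_nonneg_of_le (fun k => norm_nonneg _) (fun k => ?_)
    (hs.mul_left (2 * Real.pi * C))
  calc ‖torusCoeff (u j) k‖
      = 2 * Real.pi * (‖torusCoeff K k‖ * ‖(perp k j : ℂ)‖) * ‖torusCoeff g k‖ := by
        rw [hu.torusCoeff_eq hK hg, norm_mul, norm_mul, norm_two_pi_I, norm_mul]
        ring
    _ ≤ 2 * Real.pi * (‖torusCoeff K k‖ * freqNorm k) * ‖torusCoeff g k‖ := by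
        gcongr
        exact (norm_intCast_le_freqNorm _ j).trans (freqNorm_perp k).le
    _ ≤ 2 * Real.pi * C * ‖torusCoeff g k‖ := by
        gcongr
        exact hKC k

variable {G : Fin 2 → Torus → ℝ}

lemma integrable_transport (hK : Integrable K torusMeasure)
    (hKC : ∀ k, ‖torusCoeff K k‖ * freqNorm k ≤ C) (hg : Integrable g torusMeasure)
    (hs : Summable fun k => ‖torusCoeff g k‖) (hu : IsVelocity K g u)
    (hG : ∀ j, IsWeakPartial j g (G j)) :
    Integrable (fun x => ∑ j, u j x * G j x) torusMeasure :=
  integrable_finsetSum _ fun j _ => integrable_mul_of_summable_torusCoeff (hu.integrable j)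
    (hu.summable_norm_torusCoeff hK hKC hg hs j) (hG j).2.1

lemma hasSum_torusCoeff_transport (hK : Integrable K torusMeasure)
    (hKC : ∀ k, ‖torusCoeff K k‖ * freqNorm k ≤ C) (hg : Integrable g torusMeasure)
    (hs : Summable fun k => ‖torusCoeff g k‖) (hu : IsVelocity K g u)
    (hG : ∀ j, IsWeakPartial j g (G j)) (k : Freq) :
    HasSum (fun l => transportSymbol K k l * torusCoeff g l * torusCoeff g (k - l))
      (torusCoeff (fun x => ∑ j, u j x * G j x) k) := by
  have summable_velocity := hu.summable_norm_torusCoeff hK hKC hg hs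
  have torusCoeff_sum : torusCoeff (fun x => ∑ j, u j x * G j x) k =
      ∑ j, torusCoeff (fun x => u j x * G j x) k := by
    simp only [Fin.sum_univ_two]
    exact congrFun (torusCoeff_add
      (integrable_mul_of_summable_torusCoeff (hu.integrable 0) (summable_velocity 0) (hG 0).2.1)
      (integrable_mul_of_summable_torusCoeff (hu.integrable 1) (summable_velocity 1) (hG 1).2.1)) k
  rw [torusCoeff_sum]
  refine (hasSum_sum fun j _ => hasSum_torusCoeff_mul (hu.integrable j) (summable_velocity j)
    (hG j).2.1 k).congr_fun fun l => ?_
  simp only [transportSymbol, Finset.mul_sum, Finset.sum_mul]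
  refine Finset.sum_congr rfl fun j _ => ?_
  rw [hu.torusCoeff_eq hK hg, (hG j).torusCoeff_eq]
  ring

end Kernel

lemma summable_norm_of_sobolevSq_lt_top {E : Type*} [SeminormedAddCommGroup E] {s : ℝ} (hs : 1 < s)
    {a : Freq → E} (ha : sobolevSq s a < ⊤) : Summable fun k => ‖a k‖ := by
  have sq_lt_top : (∑' k, ‖a k‖ₑ) ^ 2 < ⊤ := (sq_tsum_enorm_le_sobolevSq s a).trans_lt
    (ENNReal.mul_lt_top (tsum_sobolevWeight_neg_lt_top hs) ha)
  rw [← tsum_enorm_ne_top_iff_summable_norm]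
  exact (ENNReal.pow_lt_top_iff.mp sq_lt_top).resolve_right two_ne_zero |>.ne

/-! ### Smooth sources -/

section Translation

variable {d : Type*} [Fintype d] {g D : UnitAddTorus d → ℂ}

lemma mFourierCoeff_comp_add_right (g : UnitAddTorus d → ℂ) (y : UnitAddTorus d) (k : d → ℤ) :
    mFourierCoeff (fun x => g (x + y)) k = mFourier k y * mFourierCoeff g k := by
  have integral_translate := integral_add_right_eq_self
    (μ := Measure.pi fun _ : d => AddCircle.haarAddCircle) (fun x => mFourier (-k) x • g x) y
  rw [mFourierCoeff, mFourierCoeff]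
  refine Eq.trans ?_ (congrArg (mFourier k y * ·) integral_translate)
  rw [← integral_const_mul]
  refine integral_congr_ae (ae_of_all _ fun x => ?_)
  have mFourier_mul_neg : mFourier k y * mFourier (-k) y = 1 := by
    rw [← mFourier_add, add_neg_cancel, mFourier_zero, ContinuousMap.one_apply]
  simp only [smul_eq_mul, mFourier_add_apply]
  linear_combination (-(mFourier (-k) x * g (x + y))) * mFourier_mul_neg

variable [DecidableEq d] {j : d}

lemma hasDerivAt_mFourierCoeff_comp_add_single (hg : Continuous g) (hD : Continuous D)
    (h : ∀ x, HasDerivAt (fun τ : ℝ => g (x + Pi.single j (τ : UnitAddCircle))) (D x) 0)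
    (k : d → ℤ) :
    HasDerivAt (fun τ : ℝ => mFourierCoeff (fun x => g (x + Pi.single j (τ : UnitAddCircle))) k)
      (mFourierCoeff D k) 0 := by
  obtain ⟨C, norm_D_le⟩ := isCompact_univ.exists_bound_of_continuousOn hD.continuousOn
  have hasDerivAt_translate (x : UnitAddTorus d) (σ : ℝ) :
      HasDerivAt (fun τ : ℝ => g (x + Pi.single j (τ : UnitAddCircle)))
        (D (x + Pi.single j (σ : UnitAddCircle))) σ := by
    have := HasDerivAt.comp_sub_const σ σ
      ((sub_self σ).symm ▸ h (x + Pi.single j (σ : UnitAddCircle)))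
    simpa only [AddCircle.coe_sub, add_assoc, ← Pi.single_add, add_sub_cancel] using this
  have hasDerivAt_integral := (hasDerivAt_integral_of_dominated_loc_of_deriv_le
    (μ := Measure.pi fun _ : d => AddCircle.haarAddCircle)
    (F := fun (τ : ℝ) x => mFourier (-k) x • g (x + Pi.single j (τ : UnitAddCircle)))
    (F' := fun (τ : ℝ) x => mFourier (-k) x • D (x + Pi.single j (τ : UnitAddCircle)))
    (x₀ := 0) (bound := fun _ => C) univ_mem
    (Eventually.of_forall fun τ => Continuous.aestronglyMeasurable (by fun_prop))
    (Continuous.integrable_of_hasCompactSupport (by fun_prop) (HasCompactSupport.of_compactSpace _))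
    (Continuous.aestronglyMeasurable (by fun_prop))
    (ae_of_all _ fun x τ _ => by
      rw [norm_smul, norm_mFourier_apply, one_mul]
      exact norm_D_le _ (mem_univ _))
    (integrable_const C)
    (ae_of_all _ fun x τ _ => (hasDerivAt_translate x τ).fun_const_smul _)).2
  simp only [AddCircle.coe_zero, Pi.single_zero, add_zero] at hasDerivAt_integral
  exact hasDerivAt_integral

lemma mFourierCoeff_eq_of_hasDerivAt (hg : Continuous g) (hD : Continuous D)
    (h : ∀ x, HasDerivAt (fun τ : ℝ => g (x + Pi.single j (τ : UnitAddCircle))) (D x) 0)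
    (k : d → ℤ) : mFourierCoeff D k = 2 * Real.pi * Complex.I * k j * mFourierCoeff g k := by
  have deriv_coeff := hasDerivAt_mFourierCoeff_comp_add_single hg hD h k
  simp only [mFourierCoeff_comp_add_right] at deriv_coeff
  exact deriv_coeff.unique ((hasDerivAt_mFourier_single k j).mul_const _)

end Translation

/-- Time-dependent functions on the torus, smooth in time and space. -/
def SmoothPath (f : ℝ → Torus → ℝ) : Prop :=
  ContDiff ℝ ∞ fun p : ℝ × (Fin 2 → ℝ) => f p.1 (toTorus p.2)

lemma isOpenQuotientMap_toTorus : IsOpenQuotientMap toTorus :=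
  IsOpenQuotientMap.piMap fun _ => QuotientAddGroup.isOpenQuotientMap_mk

lemma toTorus_add_smul_single (y : Fin 2 → ℝ) (j : Fin 2) (τ : ℝ) :
    toTorus (y + τ • Pi.single j 1) = toTorus y + Pi.single j (τ : UnitAddCircle) := by
  ext i
  rcases eq_or_ne i j with rfl | hij
  · simp [toTorus]
  · simp [toTorus, hij]

lemma torusCoeff_sub {g h : Torus → ℝ} (hg : Integrable g torusMeasure)
    (hh : Integrable h torusMeasure) :
    torusCoeff (fun x => g x - h x) = torusCoeff g - torusCoeff h := by
  have := torusCoeff_add hg (hh.const_mul (-1))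
  rw [torusCoeff_const_mul, Complex.ofReal_neg, Complex.ofReal_one, neg_one_smul] at this
  simpa only [neg_one_mul, ← sub_eq_add_neg] using this

lemma norm_torusCoeff_le {g : Torus → ℝ} {C : ℝ} (hg : ∀ x, ‖g x‖ ≤ C) (k : Freq) :
    ‖torusCoeff g k‖ ≤ C := by
  refine (norm_integral_le_of_norm_le_const (μ := torusMeasure) (C := C)
    (ae_of_all _ fun x => ?_)).trans_eq (by rw [probReal_univ, mul_one])
  rw [norm_smul, norm_mFourier_apply, one_mul, Complex.norm_real]
  exact hg x

namespace SmoothPath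

variable {f g : ℝ → Torus → ℝ}

lemma continuous_uncurry (hf : SmoothPath f) : Continuous (Function.uncurry f) :=
  (IsOpenQuotientMap.id.prodMap isOpenQuotientMap_toTorus).isQuotientMap.continuous_iff.mpr
    (ContDiff.continuous hf)

lemma continuous (hf : SmoothPath f) (t : ℝ) : Continuous (f t) :=
  hf.continuous_uncurry.comp (Continuous.prodMk_right t)

lemma integrable (hf : SmoothPath f) (t : ℝ) : Integrable (f t) torusMeasure :=
  (hf.continuous t).integrable_of_hasCompactSupport (HasCompactSupport.of_compactSpace _)

lemma continuous_torusCoeff (hf : SmoothPath f) (k : Freq) :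
    Continuous fun t => torusCoeff (f t) k := by
  have continuous_integrand :
      Continuous (Function.uncurry fun t (x : Torus) => mFourier (-k) x * (f t x : ℂ)) :=
    ((mFourier (-k)).continuous.comp continuous_snd).mul
      (Complex.continuous_ofReal.comp hf.continuous_uncurry)
  simpa only [torusCoeff_eq, Measure.restrict_univ] using
    continuous_parametric_integral_of_continuous (μ := torusMeasure) continuous_integrand
      isCompact_univ

lemma sub (hf : SmoothPath f) (hg : SmoothPath g) : SmoothPath fun t x => f t x - g t x :=
  ContDiff.sub hf hg

lemma hasDerivAt_comp_add_single (hf : SmoothPath f) (j : Fin 2) (t : ℝ) (y : Fin 2 → ℝ) :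
    HasDerivAt (fun τ : ℝ => f t (toTorus y + Pi.single j (τ : UnitAddCircle)))
      (fderiv ℝ (fun p : ℝ × (Fin 2 → ℝ) => f p.1 (toTorus p.2)) (t, y) (0, Pi.single j 1)) 0 := by
  have hasDerivAt_line : HasDerivAt (fun τ : ℝ => (t, y + τ • (Pi.single j 1 : Fin 2 → ℝ)))
      (0, Pi.single j 1) 0 := by
    simpa using (hasDerivAt_const (0 : ℝ) t).prodMk
      (((hasDerivAt_id (0 : ℝ)).smul_const (Pi.single j 1 : Fin 2 → ℝ)).const_add y)
  have hasFDerivAt : HasFDerivAt (fun p : ℝ × (Fin 2 → ℝ) => f p.1 (toTorus p.2))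
      (fderiv ℝ (fun p : ℝ × (Fin 2 → ℝ) => f p.1 (toTorus p.2)) (t, y))
      (t, y + (0 : ℝ) • (Pi.single j 1 : Fin 2 → ℝ)) := by
    rw [zero_smul, add_zero]
    exact (ContDiff.differentiable hf (by simp) (t, y)).hasFDerivAt
  simpa only [Function.comp_def, toTorus_add_smul_single] using
    hasFDerivAt.comp_hasDerivAt (0 : ℝ) hasDerivAt_line

lemma hasDerivAt_partialDeriv (hf : SmoothPath f) (j : Fin 2) (t : ℝ) (x : Torus) :
    HasDerivAt (fun τ : ℝ => f t (x + Pi.single j (τ : UnitAddCircle)))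
      (ActiveScalar.partialDeriv j (f t) x) 0 := by
  obtain ⟨y, rfl⟩ := isOpenQuotientMap_toTorus.surjective x
  exact (hf.hasDerivAt_comp_add_single j t y).differentiableAt.hasDerivAt

lemma partialDeriv (hf : SmoothPath f) (j : Fin 2) :
    SmoothPath fun t => ActiveScalar.partialDeriv j (f t) := by
  have partialDeriv_eq_fderiv :
      (fun p : ℝ × (Fin 2 → ℝ) => ActiveScalar.partialDeriv j (f p.1) (toTorus p.2)) =
      fun p => fderiv ℝ (fun p : ℝ × (Fin 2 → ℝ) => f p.1 (toTorus p.2)) p (0, Pi.single j 1) :=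
    funext fun p => (hf.hasDerivAt_comp_add_single j p.1 p.2).deriv
  rw [SmoothPath, partialDeriv_eq_fderiv]
  exact (ContDiff.fderiv_right hf (m := ∞) (by simp)).clm_apply contDiff_const

lemma torusCoeff_partialDeriv (hf : SmoothPath f) (j : Fin 2) (t : ℝ) (k : Freq) :
    torusCoeff (ActiveScalar.partialDeriv j (f t)) k =
      2 * Real.pi * Complex.I * k j * torusCoeff (f t) k :=
  mFourierCoeff_eq_of_hasDerivAt (Complex.continuous_ofReal.comp (hf.continuous t))
    (Complex.continuous_ofReal.comp ((hf.partialDeriv j).continuous t))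
    (fun x => (hf.hasDerivAt_partialDeriv j t x).ofReal_comp) k

lemma exists_sobolevWeight_one_mul_enorm_torusCoeff_le (hf : SmoothPath f) :
    ∃ g, SmoothPath g ∧
      ∀ t k, sobolevWeight 1 k * ‖torusCoeff (f t) k‖ₑ ≤ ‖torusCoeff (g t) k‖ₑ := by
  have hf₀ := (hf.partialDeriv 0).partialDeriv 0
  have hf₁ := (hf.partialDeriv 1).partialDeriv 1
  refine ⟨_, (hf.sub hf₀).sub hf₁, fun t k => ?_⟩
  have torusCoeff_eq_mul : torusCoeff (fun x => f t x -
        ActiveScalar.partialDeriv 0 (ActiveScalar.partialDeriv 0 (f t)) x -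
        ActiveScalar.partialDeriv 1 (ActiveScalar.partialDeriv 1 (f t)) x) k =
      ((1 + (2 * Real.pi) ^ 2 * freqNorm k ^ 2 : ℝ) : ℂ) * torusCoeff (f t) k := by
    rw [torusCoeff_sub ((hf.sub hf₀).integrable t) (hf₁.integrable t), Pi.sub_apply,
      torusCoeff_sub (hf.integrable t) (hf₀.integrable t), Pi.sub_apply,
      (hf.partialDeriv 0).torusCoeff_partialDeriv, (hf.partialDeriv 1).torusCoeff_partialDeriv,
      hf.torusCoeff_partialDeriv, hf.torusCoeff_partialDeriv, freqNorm_sq]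
    push_cast
    linear_combination (-(2 * Real.pi) ^ 2 * ((k 0) ^ 2 + (k 1) ^ 2) * torusCoeff (f t) k) *
      Complex.I_sq
  rw [torusCoeff_eq_mul, enorm_mul, sobolevWeight, Real.rpow_one,
    ← ofReal_norm ((_ : ℝ) : ℂ), Complex.norm_real, Real.norm_of_nonneg (by positivity)]
  gcongr
  have := Real.pi_gt_three
  exact le_mul_of_one_le_left (sq_nonneg _) (one_le_pow₀ (by linarith))

lemma exists_sobolevWeight_mul_enorm_torusCoeff_le (T : ℝ) (n : ℕ) {f : ℝ → Torus → ℝ}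
    (hf : SmoothPath f) :
    ∃ C : ℝ≥0∞, C ≠ ⊤ ∧ ∀ t ∈ Icc 0 T, ∀ k, sobolevWeight n k * ‖torusCoeff (f t) k‖ₑ ≤ C := by
  induction n generalizing f with
  | zero =>
    obtain ⟨C, norm_le⟩ := (isCompact_Icc.prod isCompact_univ).exists_bound_of_continuousOn
      (s := Icc 0 T ×ˢ (univ : Set Torus)) hf.continuous_uncurry.continuousOn
    refine ⟨ENNReal.ofReal C, ENNReal.ofReal_ne_top, fun t ht k => ?_⟩
    rw [Nat.cast_zero, sobolevWeight_zero, one_mul, ← ofReal_norm]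
    exact ENNReal.ofReal_le_ofReal
      (norm_torusCoeff_le (fun x => norm_le (t, x) ⟨ht, mem_univ _⟩) k)
  | succ n ih =>
    obtain ⟨g, hg, weight_mul_le⟩ := hf.exists_sobolevWeight_one_mul_enorm_torusCoeff_le
    obtain ⟨C, hC, enorm_le⟩ := ih hg
    refine ⟨C, hC, fun t ht k => (enorm_le t ht k).trans' ?_⟩
    rw [Nat.cast_succ, sobolevWeight_add, mul_assoc]
    gcongr
    exact weight_mul_le t k

lemma memEnergySpace (hf : SmoothPath f) (r T : ℝ) :
    MemEnergySpace r T fun t => torusCoeff (f t) where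
  aemeasurable k := (hf.continuous_torusCoeff k).measurable.aemeasurable
  energy_lt_top := by
    obtain ⟨n, hn⟩ := exists_nat_ge (r + 2)
    obtain ⟨C, hC, weight_mul_le⟩ := hf.exists_sobolevWeight_mul_enorm_torusCoeff_le T n
    have sobolevSq_le (t : ℝ) (ht : t ∈ Ioo 0 T) :
        sobolevSq r (torusCoeff (f t)) ≤ (∑' k, sobolevWeight (-2) k) * C ^ 2 := by
      rw [← ENNReal.tsum_mul_right]
      refine ENNReal.tsum_le_tsum fun k => ?_
      calc sobolevWeight r k * ‖torusCoeff (f t) k‖ₑ ^ 2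
          ≤ sobolevWeight (-2 + (n + n)) k * ‖torusCoeff (f t) k‖ₑ ^ 2 := by
            gcongr
            exact sobolevWeight_mono (by linarith [n.cast_nonneg (α := ℝ)]) k
        _ = sobolevWeight (-2) k * (sobolevWeight n k * ‖torusCoeff (f t) k‖ₑ) ^ 2 := by
            rw [sobolevWeight_add, sobolevWeight_add]
            ring
        _ ≤ sobolevWeight (-2) k * C ^ 2 := by
            gcongr
            exact weight_mul_le t (Ioo_subset_Icc_self ht) k
    have tsum_ne_top := (tsum_sobolevWeight_neg_lt_top one_lt_two).ne
    refine (setLIntegral_mono' measurableSet_Ioo sobolevSq_le).trans_lt ?_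
    rw [setLIntegral_const, Real.volume_Ioo]
    finiteness

end SmoothPath

/-- A source for which the equations can be solved mode by mode: the coefficients of `f` at
almost every time are those of an integrable function, and they make up an element of
`L²(0, T; H^r)`. -/
structure IsSobolevSource (r T : ℝ) (f : ℝ → Torus → ℝ) : Prop where
  integrable : ∀ᵐ t ∂volume.restrict (Ioo 0 T), Integrable (f t) torusMeasure
  memEnergySpace : MemEnergySpace r T fun t => torusCoeff (f t)

lemma IsTestFunction.isSobolevSource {I : Set ℝ} {f : ℝ → Torus → ℝ} (hf : IsTestFunction I f)
    (r T : ℝ) : IsSobolevSource r T f where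
  integrable := ae_of_all _ fun t => SmoothPath.integrable hf.1 t
  memEnergySpace := SmoothPath.memEnergySpace hf.1 r T

/-! ### Fourier coefficients of time-dependent functions -/

lemma torusCoeff_congr_ae {g h : Torus → ℝ} (hgh : g =ᵐ[torusMeasure] h) :
    torusCoeff g = torusCoeff h := by
  ext k
  rw [torusCoeff_eq, torusCoeff_eq]
  refine integral_congr_ae (hgh.mono fun x hx => ?_)
  simp only [hx]

lemma torusCoeff_coe_add (g h : L2Torus) :
    torusCoeff (g + h : L2Torus) = torusCoeff g + torusCoeff h :=
  (torusCoeff_congr_ae (Lp.coeFn_add g h)).trans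
    (torusCoeff_add (integrable_L2Torus g) (integrable_L2Torus h))

lemma torusCoeff_coe_sub (g h : L2Torus) :
    torusCoeff (g - h : L2Torus) = torusCoeff g - torusCoeff h :=
  (torusCoeff_congr_ae (Lp.coeFn_sub g h)).trans
    (torusCoeff_sub (integrable_L2Torus g) (integrable_L2Torus h))

lemma torusCoeff_coe_smul (c : ℝ) (g : L2Torus) :
    torusCoeff (c • g : L2Torus) = (c : ℂ) • torusCoeff g :=
  (torusCoeff_congr_ae (Lp.coeFn_smul c g)).trans (torusCoeff_const_mul c g)

lemma norm_torusCoeff_coe_le (g : L2Torus) (k : Freq) : ‖torusCoeff g k‖ ≤ ‖g‖ :=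
  calc ‖torusCoeff g k‖ ≤ ∫ x, ‖g x‖ ∂torusMeasure := by
        refine norm_integral_le_of_norm_le (integrable_L2Torus g).norm (ae_of_all _ fun x => ?_)
        rw [norm_smul, norm_mFourier_apply, one_mul, Complex.norm_real]
    _ = (eLpNorm g 1 torusMeasure).toReal := by
        rw [integral_norm_eq_lintegral_enorm (integrable_L2Torus g).1,
          eLpNorm_one_eq_lintegral_enorm]
    _ ≤ ‖g‖ := ENNReal.toReal_mono (Lp.eLpNorm_ne_top g)
        (eLpNorm_le_eLpNorm_of_exponent_le one_le_two (Lp.aestronglyMeasurable g))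

lemma continuous_torusCoeff (k : Freq) : Continuous fun g : L2Torus => torusCoeff g k := by
  refine LipschitzWith.continuous (K := 1) (LipschitzWith.of_dist_le_mul fun g h => ?_)
  rw [dist_eq_norm, dist_eq_norm, ← Pi.sub_apply, ← torusCoeff_coe_sub, NNReal.coe_one, one_mul]
  exact norm_torusCoeff_coe_le _ k

lemma aemeasurable_sobolevSq {X : Type*} [MeasurableSpace X] {μ : Measure X} (r : ℝ)
    {F : X → Freq → ℂ} (hF : ∀ k, AEMeasurable (fun t => F t k) μ) :
    AEMeasurable (fun t => sobolevSq r (F t)) μ :=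
  AEMeasurable.tsum fun k => ((hF k).enorm.pow_const 2).const_mul _

lemma bochnerNorm_two (r T : ℝ) (v : ℝ → L2Torus) :
    bochnerNorm 2 r T v = energy r T (fun t => torusCoeff (v t)) ^ (1 / 2 : ℝ) := by
  rw [bochnerNorm, eLpNorm_eq_lintegral_rpow_enorm_toReal two_ne_zero ENNReal.ofNat_ne_top, energy]
  simp only [enorm_eq_self, ENNReal.toReal_ofNat, ENNReal.rpow_two, sobolevNorm_sq]

lemma bochnerNorm_top_le {r T : ℝ} {v : ℝ → L2Torus} {M : ℝ≥0∞}
    (h : ∀ᵐ t ∂volume.restrict (Ioo 0 T), sobolevSq r (torusCoeff (v t)) ≤ M) :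
    bochnerNorm ⊤ r T v ≤ M ^ (1 / 2 : ℝ) := by
  rw [bochnerNorm, eLpNorm_exponent_top]
  refine essSup_le_of_ae_le _ (h.mono fun t ht => ?_)
  simp only [enorm_eq_self, sobolevNorm_eq]
  gcongr

namespace MemBochner

variable {p : ℝ≥0∞} {r T : ℝ} {v : ℝ → L2Torus}

lemma aemeasurable_torusCoeff (h : MemBochner p r T v) (k : Freq) :
    AEMeasurable (fun t => torusCoeff (v t) k) (volume.restrict (Ioo 0 T)) :=
  ((continuous_torusCoeff k).comp_aestronglyMeasurable h.1).aemeasurable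

lemma memEnergySpace (h : MemBochner 2 r T v) :
    MemEnergySpace r T fun t => torusCoeff (v t) where
  aemeasurable := h.aemeasurable_torusCoeff
  energy_lt_top := by
    have bochnerNorm_lt_top := h.2
    rwa [bochnerNorm_two, ENNReal.rpow_lt_top_iff_of_pos one_half_pos] at bochnerNorm_lt_top

lemma exists_ae_sobolevSq_le (h : MemBochner ⊤ r T v) : ∃ M : ℝ≥0∞, M ≠ ⊤ ∧
    ∀ᵐ t ∂volume.restrict (Ioo 0 T), sobolevSq r (torusCoeff (v t)) ≤ M := by
  refine ⟨bochnerNorm ⊤ r T v ^ 2, ENNReal.pow_ne_top h.2.ne, ?_⟩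
  filter_upwards [ae_le_eLpNormEssSup (μ := volume.restrict (Ioo 0 T))
    (f := fun t => sobolevNorm r (v t))] with t ht
  rw [← sobolevNorm_sq, bochnerNorm, eLpNorm_exponent_top]
  gcongr
  exact ht

end MemBochner

section Energy

variable {r T : ℝ} {F G : ℝ → Freq → ℂ}

lemma energy_add_le (r : ℝ)
    (hF : ∀ k, AEMeasurable (fun t => F t k) (volume.restrict (Ioo 0 T))) :
    energy r T (F + G) ≤ 2 * energy r T F + 2 * energy r T G := by
  unfold energy
  rw [← lintegral_const_mul' _ _ ENNReal.ofNat_ne_top,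
    ← lintegral_const_mul' _ _ ENNReal.ofNat_ne_top,
    ← lintegral_add_left' ((aemeasurable_sobolevSq r hF).const_mul 2)]
  exact lintegral_mono fun t => sobolevSq_add_le r (F t) (G t)

lemma energy_neg (r T : ℝ) (F : ℝ → Freq → ℂ) : energy r T (-F) = energy r T F :=
  lintegral_congr fun t => sobolevSq_neg r (F t)

lemma energy_sub_le (r : ℝ)
    (hF : ∀ k, AEMeasurable (fun t => F t k) (volume.restrict (Ioo 0 T))) :
    energy r T (F - G) ≤ 2 * energy r T F + 2 * energy r T G := by
  rw [sub_eq_add_neg, ← energy_neg r T G]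
  exact energy_add_le r hF

lemma energy_const_smul (r T : ℝ) (c : ℂ) (F : ℝ → Freq → ℂ) :
    energy r T (c • F) = ‖c‖ₑ ^ 2 * energy r T F := by
  rw [energy, energy, ← lintegral_const_mul' _ _ (by finiteness)]
  exact lintegral_congr fun t => sobolevSq_const_mul r c (F t)

lemma energy_mono_time (r : ℝ) (F : ℝ → Freq → ℂ) {t : ℝ} (ht : t ≤ T) :
    energy r t F ≤ energy r T F :=
  lintegral_mono_set (Ioo_subset_Ioo_right ht)

lemma energy_mono {q : ℝ} (h : r ≤ q) (T : ℝ) (F : ℝ → Freq → ℂ) :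
    energy r T F ≤ energy q T F :=
  lintegral_mono fun t => sobolevSq_mono h (F t)

namespace MemEnergySpace

lemma mono_time (hF : MemEnergySpace r T F) {t : ℝ} (ht : t ≤ T) : MemEnergySpace r t F where
  aemeasurable k :=
    (hF.aemeasurable k).mono_measure (Measure.restrict_mono (Ioo_subset_Ioo_right ht) le_rfl)
  energy_lt_top := (energy_mono_time r F ht).trans_lt hF.energy_lt_top

lemma congr_ae (hF : MemEnergySpace r T F) (h : F =ᵐ[volume.restrict (Ioo 0 T)] G) :
    MemEnergySpace r T G where
  aemeasurable k := (hF.aemeasurable k).congr (h.mono fun _ ht => congrFun ht k)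
  energy_lt_top := (lintegral_congr_ae (h.fun_comp (sobolevSq r))).symm.trans_lt hF.energy_lt_top

lemma add (hF : MemEnergySpace r T F) (hG : MemEnergySpace r T G) :
    MemEnergySpace r T (F + G) where
  aemeasurable k := (hF.aemeasurable k).add (hG.aemeasurable k)
  energy_lt_top := (energy_add_le r hF.aemeasurable).trans_lt <| by
    have := hF.energy_lt_top
    have := hG.energy_lt_top
    finiteness

lemma const_smul (hF : MemEnergySpace r T F) (c : ℂ) : MemEnergySpace r T (c • F) where
  aemeasurable k := (hF.aemeasurable k).const_smul c
  energy_lt_top := by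
    have := hF.energy_lt_top
    rw [energy_const_smul]
    finiteness

lemma neg (hF : MemEnergySpace r T F) : MemEnergySpace r T (-F) :=
  neg_one_smul ℂ F ▸ hF.const_smul (-1)

lemma sub (hF : MemEnergySpace r T F) (hG : MemEnergySpace r T G) :
    MemEnergySpace r T (F - G) :=
  sub_eq_add_neg F G ▸ hF.add hG.neg

lemma integrableOn (hF : MemEnergySpace r T F) (k : Freq) :
    IntegrableOn (fun t => F t k) (Ioo 0 T) := by
  have lintegral_sq_lt_top : ∫⁻ t in Ioo 0 T, ‖F t k‖ₑ ^ 2 < ⊤ := by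
    have energy_lt_top := hF.energy_lt_top
    rw [energy_eq_tsum r hF.aemeasurable] at energy_lt_top
    exact ENNReal.lt_top_of_mul_ne_top_right
      ((ENNReal.le_tsum k).trans_lt energy_lt_top).ne (sobolevWeight_ne_zero r k)
  have memLp : MemLp (fun t => F t k) 2 (volume.restrict (Ioo 0 T)) := by
    refine ⟨(hF.aemeasurable k).aestronglyMeasurable, ?_⟩
    rw [eLpNorm_lt_top_iff_lintegral_rpow_enorm_lt_top two_ne_zero ENNReal.ofNat_ne_top]
    simpa only [ENNReal.toReal_ofNat, ENNReal.rpow_two] using lintegral_sq_lt_top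
  exact memLp.integrable one_le_two

end MemEnergySpace

end Energy

section SolvesModes

variable {α r T : ℝ} {F G a b : ℝ → Freq → ℂ}

lemma integrableOn_exp_mul (lam : ℝ) {t : ℝ} (ht : t ≤ T) {φ : ℝ → ℂ}
    (hφ : IntegrableOn φ (Ioo 0 T)) :
    IntegrableOn (fun τ => (Real.exp (-(lam * (t - τ))) : ℂ) * φ τ) (Ioo 0 t) := by
  have continuous_exp : Continuous fun τ : ℝ => (Real.exp (-(lam * (t - τ))) : ℂ) := by fun_prop
  obtain ⟨C, norm_le⟩ :=
    isCompact_Icc.exists_bound_of_continuousOn (s := Icc 0 t) continuous_exp.continuousOn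
  exact (hφ.mono_set (Ioo_subset_Ioo_right ht)).bdd_mul continuous_exp.aestronglyMeasurable
    ((ae_restrict_iff' measurableSet_Ioo).mpr
      (ae_of_all _ fun τ hτ => norm_le τ (Ioo_subset_Icc_self hτ)))

namespace SolvesModes

lemma mono_time (h : SolvesModes α T F a) {t : ℝ} (ht : t ≤ T) : SolvesModes α t F a :=
  ae_restrict_of_ae_restrict_of_subset (Ioo_subset_Ioo_right ht) h

lemma congr_forcing (h : SolvesModes α T F a) (hFG : F =ᵐ[volume.restrict (Ioo 0 T)] G) :
    SolvesModes α T G a := by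
  filter_upwards [h, ae_restrict_mem measurableSet_Ioo] with t ha ht k
  rw [ha k]
  refine integral_congr_ae ?_
  filter_upwards [ae_restrict_of_ae_restrict_of_subset (Ioo_subset_Ioo_right ht.2.le) hFG]
    with τ hτ
  rw [hτ]

lemma add (hF : MemEnergySpace r T F) (hG : MemEnergySpace r T G)
    (h : SolvesModes α T F a) (h' : SolvesModes α T G b) : SolvesModes α T (F + G) (a + b) := by
  filter_upwards [h, h', ae_restrict_mem measurableSet_Ioo] with t ha hb ht k
  rw [Pi.add_apply, Pi.add_apply, ha k, hb k]
  simp only [duhamel, Pi.add_apply, mul_add]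
  exact (integral_add (integrableOn_exp_mul _ ht.2.le (hF.integrableOn k))
    (integrableOn_exp_mul _ ht.2.le (hG.integrableOn k))).symm

lemma const_smul (h : SolvesModes α T F a) (c : ℂ) : SolvesModes α T (c • F) (c • a) := by
  filter_upwards [h] with t ha k
  rw [Pi.smul_apply, Pi.smul_apply, ha k]
  simp only [duhamel, Pi.smul_apply, smul_eq_mul, mul_left_comm _ c]
  exact (integral_const_mul _ _).symm

lemma sub (hF : MemEnergySpace r T F) (hG : MemEnergySpace r T G)
    (h : SolvesModes α T F a) (h' : SolvesModes α T G b) : SolvesModes α T (F - G) (a - b) := by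
  simpa only [neg_one_smul, ← sub_eq_add_neg] using
    h.add hF (hG.const_smul (-1)) (h'.const_smul (-1))

end SolvesModes

end SolvesModes

lemma HasParabolicBound.sub {α s T : ℝ} {M M' : ℝ≥0∞} {a b : ℝ → Freq → ℂ}
    (ha : HasParabolicBound α s T M a) (hb : HasParabolicBound α s T M' b) :
    HasParabolicBound α s T (2 * M + 2 * M') (a - b) where
  aemeasurable k := (ha.aemeasurable k).sub (hb.aemeasurable k)
  energy_le := (energy_sub_le _ ha.aemeasurable).trans <| by
    gcongr
    exacts [ha.energy_le, hb.energy_le]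
  ae_sobolevSq_le := by
    filter_upwards [ha.ae_sobolevSq_le, hb.ae_sobolevSq_le] with t hat hbt
    rw [Pi.sub_apply, sub_eq_add_neg]
    refine (sobolevSq_add_le s (a t) (-b t)).trans ?_
    rw [← sobolevSq_neg s (b t)] at hbt
    gcongr
    exact hbt

namespace IsSobolevSource

variable {r T : ℝ} {f g : ℝ → Torus → ℝ}

lemma torusCoeff_add (hf : IsSobolevSource r T f) (hg : IsSobolevSource r T g) :
    (fun t => torusCoeff (f t)) + (fun t => torusCoeff (g t)) =ᵐ[volume.restrict (Ioo 0 T)]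
      fun t => torusCoeff fun x => f t x + g t x := by
  filter_upwards [hf.integrable, hg.integrable] with t hft hgt
  exact (ActiveScalar.torusCoeff_add hft hgt).symm

lemma torusCoeff_sub (hf : IsSobolevSource r T f) (hg : IsSobolevSource r T g) :
    (fun t => torusCoeff (f t)) - (fun t => torusCoeff (g t)) =ᵐ[volume.restrict (Ioo 0 T)]
      fun t => torusCoeff fun x => f t x - g t x := by
  filter_upwards [hf.integrable, hg.integrable] with t hft hgt
  exact (ActiveScalar.torusCoeff_sub hft hgt).symm

lemma add (hf : IsSobolevSource r T f) (hg : IsSobolevSource r T g) :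
    IsSobolevSource r T fun t x => f t x + g t x where
  integrable := by filter_upwards [hf.integrable, hg.integrable] with t hft hgt using hft.add hgt
  memEnergySpace := (hf.memEnergySpace.add hg.memEnergySpace).congr_ae (hf.torusCoeff_add hg)

lemma sub (hf : IsSobolevSource r T f) (hg : IsSobolevSource r T g) :
    IsSobolevSource r T fun t x => f t x - g t x where
  integrable := by filter_upwards [hf.integrable, hg.integrable] with t hft hgt using hft.sub hgt
  memEnergySpace := (hf.memEnergySpace.sub hg.memEnergySpace).congr_ae (hf.torusCoeff_sub hg)

lemma const_mul (hf : IsSobolevSource r T f) (c : ℝ) :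
    IsSobolevSource r T fun t x => c * f t x where
  integrable := hf.integrable.mono fun t hft => hft.const_mul c
  memEnergySpace := by
    simp only [torusCoeff_const_mul]
    exact hf.memEnergySpace.const_smul c

end IsSobolevSource

lemma SolvesWeakly.solvesModes {α r q T : ℝ} {f : ℝ → Torus → ℝ} {v : ℝ → L2Torus}
    (hf : IsSobolevSource r T f) (hv : MemEnergySpace q T fun t => torusCoeff (v t))
    (h : SolvesWeakly α T f v) :
    SolvesModes α T (fun t => torusCoeff (f t)) fun t => torusCoeff (v t) :=
  ae_all_iff.mpr fun k =>
    h.torusCoeff_eq_duhamel hf.integrable k (hv.integrableOn k) (hf.memEnergySpace.integrableOn k)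

lemma continuousOn_setLIntegral_Ioo {T : ℝ} {h : ℝ → ℝ≥0∞}
    (hm : AEMeasurable h (volume.restrict (Ioo 0 T))) (hfin : ∫⁻ τ in Ioo 0 T, h τ ≠ ⊤) :
    ContinuousOn (fun t => ∫⁻ τ in Ioo 0 t, h τ) (Icc 0 T) := by
  have integrableOn : IntegrableOn (fun τ => (h τ).toReal) (Icc 0 T) := by
    rw [integrableOn_Icc_iff_integrableOn_Ioo]
    exact integrable_toReal_of_lintegral_ne_top hm hfin
  refine (ENNReal.continuous_ofReal.comp_continuousOn
    (intervalIntegral.continuousOn_primitive integrableOn)).congr fun t ht => ?_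
  have hm' : AEMeasurable h (volume.restrict (Ioo 0 t)) :=
    hm.mono_measure (Measure.restrict_mono (Ioo_subset_Ioo_right ht.2) le_rfl)
  have hfin' : ∫⁻ τ in Ioo 0 t, h τ ≠ ⊤ :=
    ne_top_of_le_ne_top hfin (lintegral_mono_set (Ioo_subset_Ioo_right ht.2))
  simp only [Function.comp_apply]
  rw [integral_Ioc_eq_integral_Ioo, integral_toReal hm' (ae_lt_top' hm' hfin'),
    ENNReal.ofReal_toReal hfin']

lemma MemEnergySpace.energy_lt_of_forall_ne {r T : ℝ} (hT : 0 ≤ T) {F : ℝ → Freq → ℂ}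
    (hF : MemEnergySpace r T F) {v : ℝ≥0∞} (h : ∀ t ∈ Icc 0 T, energy r t F ≠ v) :
    energy r T F < v := by
  by_contra! v_le
  have continuousOn : ContinuousOn (fun t => energy r t F) (Icc 0 T) :=
    continuousOn_setLIntegral_Ioo (aemeasurable_sobolevSq r hF.aemeasurable) hF.energy_lt_top.ne
  have energy_zero : energy r 0 F = 0 := by
    rw [energy, Ioo_self, Measure.restrict_empty, lintegral_zero_measure]
  obtain ⟨t, ht, energy_eq⟩ :=
    intermediate_value_Icc hT continuousOn ⟨energy_zero.trans_le zero_le, v_le⟩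
  exact h t ht energy_eq

/-! ### Semilinear systems with small data -/

section Semilinear

variable {α s T : ℝ} {N : (Freq → ℂ) → Freq → ℂ} {B M : ℝ≥0∞} {a b g : ℝ → Freq → ℂ}

lemma HasQuadraticBound.energy_comp_le (hN : HasQuadraticBound α s B N)
    (ha : ∀ k, AEMeasurable (fun t => a t k) (volume.restrict (Ioo 0 T)))
    (hM : ∀ᵐ t ∂volume.restrict (Ioo 0 T), sobolevSq s (a t) ≤ M) :
    energy (s - α) T (N ∘ a) ≤ B * M * energy (s + α) T a := by
  unfold energy
  rw [← lintegral_const_mul'' _ (aemeasurable_sobolevSq _ ha)]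
  refine lintegral_mono_ae (hM.mono fun t sobolevSq_le => (hN (a t)).trans ?_)
  rw [mul_assoc]
  gcongr

namespace HasParabolicBound

lemma mono (h : HasParabolicBound α s T M a) {M' : ℝ≥0∞} (hM : M ≤ M') :
    HasParabolicBound α s T M' a where
  aemeasurable := h.aemeasurable
  energy_le := h.energy_le.trans hM
  ae_sobolevSq_le := h.ae_sobolevSq_le.mono fun _ => hM.trans'

lemma energy_comp_le (h : HasParabolicBound α s T M a) (hN : HasQuadraticBound α s B N) :
    energy (s - α) T (N ∘ a) ≤ B * M ^ 2 :=
  calc energy (s - α) T (N ∘ a) ≤ B * M * energy (s + α) T a :=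
        hN.energy_comp_le h.aemeasurable h.ae_sobolevSq_le
    _ ≤ B * M * M := by
        gcongr
        exact h.energy_le
    _ = B * M ^ 2 := by rw [mul_assoc, sq]

end HasParabolicBound

/-- The coefficients `a` solve `a' + |2πk|^{2α} a + N(a) = g`, `a(0) = 0`, on `(0, T)`. The
nonlinearity `N` acts on all the coefficients at one time, and `N(a)` belongs to
`L²(0, T; H^{s-α})`. -/
structure SolvesSemilinear (α s T : ℝ) (N : (Freq → ℂ) → Freq → ℂ) (g a : ℝ → Freq → ℂ) :
    Prop where
  aemeasurable (k : Freq) : AEMeasurable (fun t => a t k) (volume.restrict (Ioo 0 T))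
  memEnergySpace : MemEnergySpace (s - α) T (N ∘ a)
  solves : SolvesModes α T (g - N ∘ a) a

namespace SolvesSemilinear

lemma hasParabolicBound (hα : 0 ≤ α) (hg : MemEnergySpace (s - α) T g)
    (h : SolvesSemilinear α s T N g a) {t : ℝ} (ht : t ∈ Icc 0 T) :
    HasParabolicBound α s t (ENNReal.ofReal (1 + T) ^ 2 * energy (s - α) t (g - N ∘ a)) a := by
  have forcing := (hg.sub h.memEnergySpace).mono_time ht.2
  have aemeasurable (k : Freq) : AEMeasurable (fun τ => a τ k) (volume.restrict (Ioo 0 t)) :=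
    (h.aemeasurable k).mono_measure (Measure.restrict_mono (Ioo_subset_Ioo_right ht.2) le_rfl)
  refine ((h.solves.mono_time ht.2).hasParabolicBound hα ht.1 s forcing.aemeasurable
    aemeasurable).mono ?_
  gcongr
  exact ht.2

-- At the first time at which the energy of the forcing reaches `v`, the parabolic estimate and
-- the quadratic bound would show it to be smaller than `v`.
lemma energy_forcing_lt (hα : 0 ≤ α) (hT : 0 ≤ T) (hN : HasQuadraticBound α s B N)
    (hg : MemEnergySpace (s - α) T g) (h : SolvesSemilinear α s T N g a) {v : ℝ≥0∞}
    (hv : 2 * energy (s - α) T g + 2 * (B * (ENNReal.ofReal (1 + T) ^ 2 * v) ^ 2) < v) :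
    energy (s - α) T (g - N ∘ a) < v := by
  refine (hg.sub h.memEnergySpace).energy_lt_of_forall_ne hT fun t ht energy_eq => hv.not_ge ?_
  have parabolic := h.hasParabolicBound hα hg ht
  rw [energy_eq] at parabolic
  calc v = energy (s - α) t (g - N ∘ a) := energy_eq.symm
    _ ≤ 2 * energy (s - α) t g + 2 * energy (s - α) t (N ∘ a) :=
        energy_sub_le _ (hg.mono_time ht.2).aemeasurable
    _ ≤ _ := by
        gcongr
        · exact energy_mono_time _ g ht.2
        · exact parabolic.energy_comp_le hN

lemma hasParabolicBound_of_small (hα : 0 ≤ α) (hT : 0 ≤ T) (hN : HasQuadraticBound α s B N)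
    (hg : MemEnergySpace (s - α) T g) (h : SolvesSemilinear α s T N g a) {v : ℝ≥0∞}
    (hv : 2 * energy (s - α) T g + 2 * (B * (ENNReal.ofReal (1 + T) ^ 2 * v) ^ 2) < v) :
    HasParabolicBound α s T (ENNReal.ofReal (1 + T) ^ 2 * v) a := by
  refine (h.hasParabolicBound hα hg (right_mem_Icc.mpr hT)).mono ?_
  gcongr
  exact (h.energy_forcing_lt hα hT hN hg hv).le

lemma hasParabolicBound_inv_smul_sub (hα : 0 ≤ α) (hT : 0 ≤ T) (hN : HasQuadraticBound α s B N)
    (hg : MemEnergySpace (s - α) T g) {c : ℂ} (hc : c ≠ 0)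
    (h : SolvesSemilinear α s T N (c • g) a) (ha : HasParabolicBound α s T M a)
    (hb : ∀ k, AEMeasurable (fun t => b t k) (volume.restrict (Ioo 0 T)))
    (hgb : SolvesModes α T g b) :
    HasParabolicBound α s T
      (ENNReal.ofReal (1 + T) ^ 2 * (‖c⁻¹‖ₑ ^ 2 * (B * M ^ 2))) (c⁻¹ • a - b) := by
  have forcing := (hg.const_smul c).sub h.memEnergySpace
  have solves : SolvesModes α T (c⁻¹ • (c • g - N ∘ a) - g) (c⁻¹ • a - b) :=
    (h.solves.const_smul c⁻¹).sub (forcing.const_smul c⁻¹) hg hgb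
  rw [smul_sub, inv_smul_smul₀ hc, sub_sub_cancel_left] at solves
  refine (solves.hasParabolicBound hα hT s (h.memEnergySpace.const_smul c⁻¹).neg.aemeasurable
    fun k => ((h.aemeasurable k).const_smul c⁻¹).sub (hb k)).mono ?_
  rw [energy_neg, energy_const_smul]
  gcongr
  exact ha.energy_comp_le hN

end SolvesSemilinear

lemma tendsto_const_mul_enorm_sq {Q : ℝ≥0∞} (hQ : Q ≠ ⊤) :
    Tendsto (fun ε : ℝ => Q * ‖ε‖ₑ ^ 2) (𝓝[≠] 0) (𝓝 0) := by
  have continuous : Continuous fun ε : ℝ => Q * ‖ε‖ₑ ^ 2 :=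
    (ENNReal.continuous_const_mul hQ).comp ((ENNReal.continuous_pow 2).comp continuous_enorm)
  simpa using (continuous.tendsto 0).mono_left nhdsWithin_le_nhds

lemma exists_hasParabolicBound_inv_smul_sub (hα : 0 ≤ α) (hT : 0 ≤ T) (hB : B ≠ ⊤)
    (hN : HasQuadraticBound α s B N) (hg : MemEnergySpace (s - α) T g)
    (hb : ∀ k, AEMeasurable (fun t => b t k) (volume.restrict (Ioo 0 T)))
    (hgb : SolvesModes α T g b) :
    ∃ Q : ℝ≥0∞, Q ≠ ⊤ ∧ ∀ᶠ ε : ℝ in 𝓝[≠] 0, ∀ a, SolvesSemilinear α s T N ((ε : ℂ) • g) a →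
      HasParabolicBound α s T (Q * ‖ε‖ₑ ^ 2) ((ε : ℂ)⁻¹ • a - b) := by
  set P := ENNReal.ofReal (1 + T) with hP
  set E := energy (s - α) T g
  have energy_ne_top : E ≠ ⊤ := hg.energy_lt_top.ne
  have small : ∀ᶠ ε : ℝ in 𝓝[≠] 0, 2 * B * P ^ 4 * (2 * E + 1) ^ 2 * ‖ε‖ₑ ^ 2 < 1 :=
    (tendsto_const_mul_enorm_sq (by finiteness)).eventually_lt_const one_pos
  refine ⟨P ^ 6 * B * (2 * E + 1) ^ 2, by finiteness, ?_⟩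
  filter_upwards [small, self_mem_nhdsWithin] with ε ε_small ε_ne_zero a h
  have enorm_ofReal : ‖(ε : ℂ)‖ₑ = ‖ε‖ₑ := by
    rw [← ofReal_norm, Complex.norm_real, ofReal_norm]
  have enorm_ne_zero : ‖ε‖ₑ ≠ 0 := enorm_ne_zero.mpr ε_ne_zero
  have threshold : 2 * energy (s - α) T ((ε : ℂ) • g) +
      2 * (B * (P ^ 2 * (‖ε‖ₑ ^ 2 * (2 * E + 1))) ^ 2) < ‖ε‖ₑ ^ 2 * (2 * E + 1) :=
    calc _ = ‖ε‖ₑ ^ 2 * (2 * E + 2 * B * P ^ 4 * (2 * E + 1) ^ 2 * ‖ε‖ₑ ^ 2) := by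
          rw [energy_const_smul, enorm_ofReal]
          ring
      _ < ‖ε‖ₑ ^ 2 * (2 * E + 1) := by
          refine ENNReal.mul_lt_mul_right (pow_ne_zero 2 enorm_ne_zero) (by finiteness) ?_
          exact ENNReal.add_lt_add_left (by finiteness) ε_small
  have parabolic := h.hasParabolicBound_of_small hα hT hN (hg.const_smul ε) threshold
  refine (h.hasParabolicBound_inv_smul_sub hα hT hN hg (Complex.ofReal_ne_zero.mpr ε_ne_zero)
    parabolic hb hgb).mono (le_of_eq ?_)
  rw [enorm_inv (Complex.ofReal_ne_zero.mpr ε_ne_zero), enorm_ofReal, ← hP]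
  calc _ = P ^ 6 * B * (2 * E + 1) ^ 2 * ‖ε‖ₑ ^ 2 * (‖ε‖ₑ⁻¹ * ‖ε‖ₑ) ^ 2 := by ring
    _ = _ := by rw [ENNReal.inv_mul_cancel enorm_ne_zero enorm_ne_top, one_pow, mul_one]

end Semilinear

/-! ### Linearization of the active scalar equation -/

lemma aemeasurable_transportCoeff {K : Torus → ℝ} {a : ℝ → Freq → ℂ} {μ : Measure ℝ}
    (ha : ∀ k, AEMeasurable (fun t => a t k) μ) {k : Freq}
    (h : ∀ᵐ t ∂μ, Summable fun l => transportSymbol K k l * a t l * a t (k - l)) :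
    AEMeasurable (fun t => transportCoeff K (a t) k) μ :=
  aemeasurable_of_tendsto_metrizable_ae atTop
    (fun S : Finset Freq => S.aemeasurable_fun_sum fun l _ =>
      ((ha l).const_mul _).mul (ha (k - l)))
    (h.mono fun _ summable => summable.hasSum)

section ActiveScalarEquation

variable {α s T C : ℝ} {K : Torus → ℝ} {f : ℝ → Torus → ℝ}

lemma IsActiveScalarSolution.solvesSemilinear (hs : 1 < s) (hK : Integrable K torusMeasure)
    (hKC : ∀ k, ‖torusCoeff K k‖ * freqNorm k ≤ C) {B : ℝ≥0∞} (hB : B ≠ ⊤)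
    (hN : HasQuadraticBound α s B (transportCoeff K)) (hf : IsSobolevSource (s - α) T f)
    {θ : ℝ → L2Torus} (h : IsActiveScalarSolution α s T K f θ) :
    SolvesSemilinear α s T (transportCoeff K) (fun t => torusCoeff (f t))
      fun t => torusCoeff (θ t) := by
  obtain ⟨u, G, velocity_gradient, solves⟩ := h.solves
  obtain ⟨M, hM, sobolevSq_le⟩ := h.memLinfty.exists_ae_sobolevSq_le
  have summable : ∀ᵐ t ∂volume.restrict (Ioo 0 T), Summable fun k => ‖torusCoeff (θ t) k‖ :=
    sobolevSq_le.mono fun t ht => summable_norm_of_sobolevSq_lt_top hs (ht.trans_lt hM.lt_top)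
  have integrable : ∀ᵐ t ∂volume.restrict (Ioo 0 T),
      Integrable (fun x => ∑ j, u t j x * G t j x) torusMeasure := by
    filter_upwards [velocity_gradient, summable] with t ⟨hu, hG⟩ hsum
    exact integrable_transport hK hKC (integrable_L2Torus (θ t)) hsum hu hG
  have hasSum : ∀ᵐ t ∂volume.restrict (Ioo 0 T), ∀ k, HasSum
      (fun l => transportSymbol K k l * torusCoeff (θ t) l * torusCoeff (θ t) (k - l))
      (torusCoeff (fun x => ∑ j, u t j x * G t j x) k) := by
    filter_upwards [velocity_gradient, summable] with t ⟨hu, hG⟩ hsum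
    exact hasSum_torusCoeff_transport hK hKC (integrable_L2Torus (θ t)) hsum hu hG
  have memEnergySpace : MemEnergySpace (s - α) T
      (transportCoeff K ∘ fun t => torusCoeff (θ t)) := by
    refine ⟨fun k => aemeasurable_transportCoeff h.memL2.aemeasurable_torusCoeff
      (hasSum.mono fun t ht => (ht k).summable), ?_⟩
    have energy_lt_top := h.memL2.memEnergySpace.energy_lt_top
    exact (hN.energy_comp_le h.memL2.aemeasurable_torusCoeff sobolevSq_le).trans_lt (by finiteness)
  have transport_eq : (transportCoeff K ∘ fun t => torusCoeff (θ t))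
      =ᵐ[volume.restrict (Ioo 0 T)] fun t => torusCoeff fun x => ∑ j, u t j x * G t j x :=
    hasSum.mono fun t ht => funext fun k => (ht k).tsum_eq
  have transport : IsSobolevSource (s - α) T fun t x => ∑ j, u t j x * G t j x :=
    ⟨integrable, memEnergySpace.congr_ae transport_eq⟩
  refine ⟨h.memL2.aemeasurable_torusCoeff, memEnergySpace,
    (solves.solvesModes (hf.sub transport) h.memL2.memEnergySpace).congr_forcing ?_⟩
  exact (hf.torusCoeff_sub transport).symm.trans (EventuallyEq.rfl.sub transport_eq.symm)

/-- As `ε → 0`, `v_ε - v₀` is `O(ε)` in `L²(0, T; H^{s+α}) ∩ L^∞(0, T; H^s)`. -/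
def ConvergesLinearly (α s T : ℝ) (v : ℝ → ℝ → L2Torus) (v₀ : ℝ → L2Torus) : Prop :=
  ∃ Q : ℝ≥0∞, Q ≠ ⊤ ∧ ∀ᶠ ε : ℝ in 𝓝[≠] 0,
    HasParabolicBound α s T (Q * ‖ε‖ₑ ^ 2) fun t => torusCoeff (v ε t - v₀ t : L2Torus)

namespace ConvergesLinearly

variable {v v' : ℝ → ℝ → L2Torus} {v₀ v₀' : ℝ → L2Torus}

lemma sub (h : ConvergesLinearly α s T v v₀) (h' : ConvergesLinearly α s T v' v₀') :
    ConvergesLinearly α s T (fun ε t => v ε t - v' ε t) fun t => v₀ t - v₀' t := by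
  obtain ⟨Q, hQ, bound⟩ := h
  obtain ⟨Q', hQ', bound'⟩ := h'
  refine ⟨2 * Q + 2 * Q', by finiteness, ?_⟩
  filter_upwards [bound, bound'] with ε hε hε'
  convert hε.sub hε' using 1
  · ring
  · ext t : 1
    rw [Pi.sub_apply, ← torusCoeff_coe_sub, sub_sub_sub_comm]

lemma convergesTo (hαs : α ≤ s) (h : ConvergesLinearly α s T v v₀) : ConvergesTo α T v v₀ := by
  obtain ⟨Q, hQ, bound⟩ := h
  have tendsto_sqrt : Tendsto (fun ε : ℝ => (Q * ‖ε‖ₑ ^ 2) ^ (1 / 2 : ℝ)) (𝓝[≠] 0) (𝓝 0) := by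
    simpa using (tendsto_const_mul_enorm_sq hQ).ennrpow_const (1 / 2 : ℝ)
  constructor <;> refine tendsto_of_tendsto_of_tendsto_of_le_of_le' tendsto_const_nhds
    tendsto_sqrt (Eventually.of_forall fun _ => zero_le) (bound.mono fun ε hε => ?_)
  · rw [bochnerNorm_two]
    gcongr
    exact (energy_mono (by linarith) T _).trans hε.energy_le
  · exact bochnerNorm_top_le (hε.ae_sobolevSq_le.mono fun t ht => (sobolevSq_mono hαs _).trans ht)

end ConvergesLinearly

lemma convergesLinearly_inv_smul (hα : 1 / 2 ≤ α) (hαs : α ≤ s) (hs : 2 < s + α) (hT : 0 ≤ T)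
    (hK : Integrable K torusMeasure) (hKC : ∀ k, ‖torusCoeff K k‖ * freqNorm k ≤ C)
    (hf : IsSobolevSource (s - α) T f) {w : ℝ → L2Torus}
    (hw : ∀ k, AEMeasurable (fun t => torusCoeff (w t) k) (volume.restrict (Ioo 0 T)))
    (hfw : SolvesModes α T (fun t => torusCoeff (f t)) fun t => torusCoeff (w t))
    {θ : ℝ → ℝ → L2Torus} (hθ : ∀ᶠ ε : ℝ in 𝓝[≠] 0,
      IsActiveScalarSolution α s T K (fun t x => ε * f t x) (θ ε)) :
    ConvergesLinearly α s T (fun ε t => ε⁻¹ • θ ε t) w := by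
  obtain ⟨B, hB, hN⟩ := exists_hasQuadraticBound_transportCoeff hα hαs hs hKC
  obtain ⟨Q, hQ, bound⟩ := exists_hasParabolicBound_inv_smul_sub (by linarith) hT hB hN
    hf.memEnergySpace hw hfw
  refine ⟨Q, hQ, ?_⟩
  filter_upwards [bound, hθ] with ε hε solution
  have semilinear := solution.solvesSemilinear (by linarith) hK hKC hB hN (hf.const_mul ε)
  simp only [torusCoeff_const_mul] at semilinear
  convert hε _ semilinear using 1
  ext t : 1
  rw [torusCoeff_coe_sub, torusCoeff_coe_smul, Complex.ofReal_inv]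
  rfl

end ActiveScalarEquation

end ActiveScalar

end

theorem proposition4p2_general (α s r C T : ℝ) (hα : 1 / 2 ≤ α) (hαs : α ≤ s) (hs : 2 < s + α)
    (hT : 0 ≤ T) (K : Torus → ℝ) (hK : Integrable K torusMeasure)
    (hKC : ∀ k, ‖torusCoeff K k‖ * freqNorm k ≤ C)
    (f : Fin 2 → ℝ → Torus → ℝ) (hf : ∀ j, IsSobolevSource (s - α) T (f j))
    (w : Fin 2 → ℝ → L2Torus) (hw : ∀ j, MemBochner 2 r T (w j))
    (hfw : ∀ j, SolvesWeakly α T (f j) (w j))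
    (θ : Fin 2 → ℝ → ℝ → L2Torus)
    (hθ : ∀ j, ∀ᶠ ε : ℝ in 𝓝[≠] 0,
      IsActiveScalarSolution α s T K (fun t x => ε * f j t x) (θ j ε))
    (Θ : ℝ → ℝ → L2Torus)
    (hΘ : ∀ᶠ ε : ℝ in 𝓝[≠] 0,
      IsActiveScalarSolution α s T K (fun t x => ε * (f 0 t x + f 1 t x)) (Θ ε)) :
    ∀ j : Fin 2,
      ConvergesLinearly α s T (fun ε t => ε⁻¹ • θ j ε t) (w j) ∧
      ConvergesLinearly α s T (fun ε t => ε⁻¹ • (Θ ε t - θ j ε t)) (w (1 - j)) := by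
  have linear (j : Fin 2) := (hfw j).solvesModes (hf j) (hw j).memEnergySpace
  have single (j : Fin 2) : ConvergesLinearly α s T (fun ε t => ε⁻¹ • θ j ε t) (w j) :=
    convergesLinearly_inv_smul hα hαs hs hT hK hKC (hf j) (hw j).aemeasurable_torusCoeff
      (linear j) (hθ j)
  have torusCoeff_sum : (fun t => torusCoeff (w 0 t + w 1 t : L2Torus)) =
      (fun t => torusCoeff (w 0 t)) + fun t => torusCoeff (w 1 t) :=
    funext fun t => torusCoeff_coe_add (w 0 t) (w 1 t)
  have sum : ConvergesLinearly α s T (fun ε t => ε⁻¹ • Θ ε t) (fun t => w 0 t + w 1 t) := by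
    refine convergesLinearly_inv_smul hα hαs hs hT hK hKC ((hf 0).add (hf 1))
      (((hw 0).memEnergySpace.add (hw 1).memEnergySpace).congr_ae
        (.of_eq torusCoeff_sum.symm)).aemeasurable ?_ hΘ
    rw [torusCoeff_sum]
    exact ((linear 0).add (hf 0).memEnergySpace (hf 1).memEnergySpace (linear 1)).congr_forcing
      ((hf 0).torusCoeff_add (hf 1))
  intro j
  have sum_sub (t : ℝ) : w 0 t + w 1 t - w j t = w (1 - j) t := by fin_cases j <;> simp
  refine ⟨single j, ?_⟩
  simpa only [sum_sub, ← smul_sub] using sum.sub (single j)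

theorem proposition4p2 (α s T : ℝ) (hα : 1 / 2 < α) (hα' : α < 1) (hs : 2 < s + α) (hT : 0 < T)
    (K : Torus → ℝ) (hK : IsAdmissibleKernel K)
    (f : Fin 2 → ℝ → Torus → ℝ) (hf : ∀ j, IsTestFunction (Ioo 0 T) (f j))
    (w : Fin 2 → ℝ → L2Torus) (hw : ∀ j, IsLinearSolution α T (f j) (w j))
    (θ : Fin 2 → ℝ → ℝ → L2Torus)
    (hθ : ∀ j, ∀ᶠ ε : ℝ in 𝓝[≠] 0,
      IsActiveScalarSolution α s T K (fun t x => ε * f j t x) (θ j ε))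
    (Θ : ℝ → ℝ → L2Torus)
    (hΘ : ∀ᶠ ε : ℝ in 𝓝[≠] 0,
      IsActiveScalarSolution α s T K (fun t x => ε * (f 0 t x + f 1 t x)) (Θ ε)) :
    ∀ j : Fin 2,
      ConvergesTo α T (fun ε t => ε⁻¹ • θ j ε t) (w j) ∧
      ConvergesTo α T (fun ε t => ε⁻¹ • (Θ ε t - θ j ε t)) (w (1 - j)) := by
  have hαs : α ≤ s := by linarith
  obtain ⟨C, hKC⟩ := hK.exists_norm_torusCoeff_mul_freqNorm_le
  have general := proposition4p2_general α s α C T hα.le hαs hs hT.le K hK.integrable hKC f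
    (fun j => (hf j).isSobolevSource (s - α) T) w (fun j => (hw j).memL2) (fun j => (hw j).solves)
    θ hθ Θ hΘ
  exact fun j => ⟨(general j).1.convergesTo hαs, (general j).2.convergesTo hαs⟩
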